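/- **Setting.** For $N\ge 1$ let $\Gamma(N)\subset SL_2(\mathbb Z)$ be the principal congruence subgroup of level $N$. All vector spaces and algebras are over $\mathbb C$. For $k\ge 0$ let $\mathcal M_k$ be the space of functions on the upper half plane $\mathbb H$ that are modular forms of weight $k$ for some $\Gamma(N)$, $N\ge 1$, and let $\mathcal M=\bigoplus_{k\ge 0}\mathcal M_k$. A holomorphic function $f$ on $\mathbb H$ is *quasimodular* of level $N$, weight $k$ and depth at most $s$ if there are holomorphic functions $f_0,\dots,f_s$ on $\mathbb H$ such that $$(cz+d)^{-k}f\Big(\frac{az+b}{cz+d}\Big)=\sum_{j=0}^s f_j(z)\Big(\frac{c}{cz+d}\Big)^j\qquad \forall z\in\mathbb H,\ \begin{pmatrix}a&b\\c&d\end{pmatrix}\in\Gamma(N),$$ and each $f_j$ is holomorphic at all cusps, i.e. for every $\begin{pmatrix}a&b\\c&d\end{pmatrix}\in SL_2(\mathbb Z)$ the function $(cz+d)^{-(k-2j)}f_j\big(\frac{az+b}{cz+d}\big)$ is bounded as $\mathrm{Im}\,z\to\infty$. Let $\mathcal{QM}_k$ be the space of functions that are quasimodular of weight $k$ for some level $N\ge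 1$ and some depth, and $\mathcal{QM}=\bigoplus_{k\ge0}\mathcal{QM}_k$; both $\mathcal M$ and $\mathcal{QM}$ are graded commutative algebras under multiplication of functions. Let $$G_2(z)=-\frac{B_2}{4}+\sum_{n\ge1}\Big(\sum_{d\mid n}d\Big)e^{2\pi i n z}\in\mathcal{QM}_2 .$$ By the structure theorem for quasimodular forms every $f\in\mathcal{QM}$ can be written uniquely as a finite sum $f=\sum_i a_i(f)G_2^i$ with $a_i(f)\in\mathcal M$. For $\alpha=\begin{pmatrix}a&b\\c&d\end{pmatrix}\in GL_2^+(\mathbb Q)$ and $f\in\mathcal M_k$ put $(f|\alpha)(z)=(cz+d)^{-k}f\big(\frac{az+b}{cz+d}\big)$; extend $|\alpha$ linearly to $\mathcal M$ and put $f\|\alpha=\sum_i (a_i(f)|\alpha)\,G_2^i$ for $f\in\mathcal{QM}$. On $\mathcal M$ let $Y:\mathcal M_k\to\mathcal M_k$ and $X:\mathcal M_k\to\mathcal M_{k+2}$ be $$Y(f)=\frac k2 f,\qquad X(f)=\frac1{2\pi i}\frac{d}{dz}f-\frac1{12\pi i}\frac{d}{dz}(\log\Delta)\cdot Y(f),\qquad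 \Delta(z)=(2\pi)^{12}q\prod_{n\ge1}(1-q^n)^{24},\ q=e^{2\pi iz},$$ and extend them to $\mathcal{QM}$ by $X(f)=\sum_iX(a_i(f))G_2^i$, $Y(f)=\sum_iY(a_i(f))G_2^i$. Let $\sigma\in SL_2(\mathbb Z)$ and $\Gamma=\Gamma(N)$, $N\geq 1$. Let $\mathcal Q_\sigma(\Gamma)$ be the vector space of functions of finite support $$F:\Gamma\backslash GL_2^+(\mathbb Q)\to\mathcal{QM},\quad \Gamma\alpha\mapsto F_\alpha,\qquad\text{with } F_{\alpha\gamma}=F_\alpha\|\sigma\gamma\sigma^{-1}\quad\forall\gamma\in\Gamma .$$ Let $\mathfrak l_1$ be the complex Lie algebra with basis $X,Y$ and $[Y,X]=X$, let $\mathfrak h_1=U(\mathfrak l_1)$ be its universal enveloping algebra, and let $\Delta:\mathfrak h_1\to\mathfrak h_1\otimes\mathfrak h_1$, $\Delta(h)=\sum h_{(1)}\otimes h_{(2)}$, be its coproduct, the algebra homomorphism with $\Delta(u)=u\otimes1+1\otimes u$ for $u\in\mathfrak l_1$. **Statement.** The formula $$(F^1,F^2)_\alpha=\sum_{\beta\in\Gamma\backslash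 SL_2(\mathbb Z)}F^1_{\beta\sigma}\cdot\big(F^2_{\alpha\sigma^{-1}\beta^{-1}}\|\sigma\beta\big)$$ does not depend on the choice of coset representatives and defines a bilinear pairing $\mathcal Q_\sigma(\Gamma)\times\mathcal Q_\sigma(\Gamma)\to\mathcal Q_\sigma(\Gamma)$, and the following hold. (a) The formulas $$X(F)_\alpha=X(F_\alpha),\qquad Y(F)_\alpha=Y(F_\alpha)\qquad\forall F\in\mathcal Q_\sigma(\Gamma),\ \alpha\in GL_2^+(\mathbb Q)$$ define a Lie action of $\mathfrak l_1$ on $\mathcal Q_\sigma(\Gamma)$. (b) For the induced action of $\mathfrak h_1$ on $\mathcal Q_\sigma(\Gamma)$ one has $$h(F^1,F^2)=\sum\big(h_{(1)}(F^1),h_{(2)}(F^2)\big)\qquad\forall h\in\mathfrak h_1,\ F^1,F^2\in\mathcal Q_\sigma(\Gamma).$$ -/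

import Mathlib

open UpperHalfPlane hiding I
open Complex hiding Gamma
open CongruenceSubgroup Matrix.SpecialLinearGroup
open scoped MatrixGroups ModularForm Manifold DirectSum TensorProduct

attribute [local instance 100] LieRing.ofAssociativeRing

noncomputable section

namespace QMHecke

/-! ### The modular tower -/

lemma Gamma_le_of_dvd {N M : ℕ} (h : N ∣ M) : Gamma M ≤ Gamma N := by
  intro γ hγ
  rw [Gamma_mem] at hγ ⊢
  obtain ⟨h1, h2, h3, h4⟩ := hγ
  have key : ∀ a b : ℤ, (a : ZMod M) = (b : ZMod M) → (a : ZMod N) = (b : ZMod N) := by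
    intro a b hab
    rw [ZMod.intCast_eq_intCast_iff_dvd_sub] at hab ⊢
    exact (Int.natCast_dvd_natCast.mpr h).trans hab
  refine ⟨?_, ?_, ?_, ?_⟩
  · simpa using key _ 1 (by simpa using h1)
  · simpa using key _ 0 (by simpa using h2)
  · simpa using key _ 0 (by simpa using h3)
  · simpa using key _ 1 (by simpa using h4)

/-- Unbundled description of modular forms of weight `k` for `Γ(N)`. -/
def IsModular (N : ℕ) (k : ℤ) (f : ℍ → ℂ) : Prop :=
  (∀ γ ∈ Gamma N, f ∣[k] γ = f) ∧ MDiff f ∧ ∀ γ : SL(2, ℤ), IsBoundedAtImInfty (f ∣[k] γ)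

lemma exists_modularForm_iff {N : ℕ} (hN : N ≠ 0) {k : ℤ} {f : ℍ → ℂ} :
    (∃ g : ModularForm ((Gamma N).map (mapGL ℝ)) k, ⇑g = f) ↔ IsModular N k f := by
  have : NeZero N := ⟨hN⟩
  have hcusp : ∀ c : OnePoint ℝ,
      IsCusp c ((Gamma N).map (mapGL ℝ)) ↔ IsCusp c 𝒮ℒ := fun c =>
    Subgroup.IsArithmetic.isCusp_iff_isCusp_SL2Z _
  constructor
  · rintro ⟨g, rfl⟩
    refine ⟨fun γ hγ => ?_, g.holo', fun γ => ?_⟩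
    · exact SlashInvariantFormClass.slash_action_eq g _ ⟨γ, hγ, rfl⟩
    · have hc : IsCusp (mapGL ℝ γ • OnePoint.infty) 𝒮ℒ := isCusp_SL2Z_iff'.mpr ⟨γ, rfl⟩
      exact (OnePoint.isBoundedAt_iff_forall_SL2Z hc).mp
        (g.bdd_at_cusps' ((hcusp _).mpr hc)) γ rfl
  · rintro ⟨h1, h2, h3⟩
    refine ⟨⟨⟨f, ?_⟩, h2, ?_⟩, rfl⟩
    · rintro _ ⟨γ, hγ, rfl⟩
      exact h1 γ hγ
    · intro c hc
      exact (OnePoint.isBoundedAt_iff_forall_SL2Z ((hcusp _).mp hc)).mpr fun γ _ => h3 γ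

lemma IsModular.mono {N M : ℕ} (h : N ∣ M) {k : ℤ} {f : ℍ → ℂ} (hf : IsModular N k f) :
    IsModular M k f :=
  ⟨fun γ hγ => hf.1 γ (Gamma_le_of_dvd h hγ), hf.2⟩

lemma IsModular.mul {N : ℕ} {k l : ℤ} {f g : ℍ → ℂ} (hf : IsModular N k f)
    (hg : IsModular N l g) : IsModular N (k + l) (f * g) := by
  refine ⟨fun γ hγ => ?_, hf.2.1.mul hg.2.1, fun γ => ?_⟩
  · rw [ModularForm.mul_slash_SL2, hf.1 γ hγ, hg.1 γ hγ]
  · rw [ModularForm.mul_slash_SL2]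
    exact (hf.2.2 γ).mul (hg.2.2 γ)

/-- `M_k`: functions on `ℍ` which are modular forms of weight `k` for some `Γ(N)`, `N ≥ 1`. -/
def modTower (k : ℕ) : Submodule ℂ (ℍ → ℂ) where
  carrier := {f | ∃ N : ℕ, N ≠ 0 ∧
    ∃ g : ModularForm ((Gamma N).map (mapGL ℝ)) (k : ℤ), ⇑g = f}
  zero_mem' := ⟨1, one_ne_zero, 0, rfl⟩
  add_mem' := by
    rintro f g ⟨N, hN, hf⟩ ⟨M, hM, hg⟩
    rw [exists_modularForm_iff hN] at hf
    rw [exists_modularForm_iff hM] at hg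
    refine ⟨N * M, mul_ne_zero hN hM, (exists_modularForm_iff (mul_ne_zero hN hM)).mpr ?_⟩
    have hf' := hf.mono (Dvd.intro M rfl)
    have hg' := hg.mono (Dvd.intro_left N rfl)
    refine ⟨fun γ hγ => ?_, hf.2.1.add hg.2.1, fun γ => ?_⟩
    · rw [SlashAction.add_slash, hf'.1 γ hγ, hg'.1 γ hγ]
    · rw [SlashAction.add_slash]
      exact (hf'.2.2 γ).add (hg'.2.2 γ)
  smul_mem' := by
    rintro c f ⟨N, hN, hf⟩
    rw [exists_modularForm_iff hN] at hf
    refine ⟨N, hN, (exists_modularForm_iff hN).mpr ⟨fun γ hγ => ?_, hf.2.1.const_smul c,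
      fun γ => ?_⟩⟩
    · rw [ModularForm.SL_smul_slash, hf.1 γ hγ]
    · rw [ModularForm.SL_smul_slash]
      exact (hf.2.2 γ).const_smul_left c

lemma mem_modTower {k : ℕ} {f : ℍ → ℂ} :
    f ∈ modTower k ↔ ∃ N : ℕ, N ≠ 0 ∧ IsModular N k f :=
  exists_congr fun _ => and_congr_right fun hN => exists_modularForm_iff hN

lemma isModular_one : IsModular 1 0 1 :=
  ⟨fun γ _ => ModularForm.is_invariant_one γ, mdifferentiable_const, fun γ => by
    rw [ModularForm.is_invariant_one]
    exact Filter.const_boundedAtFilter _ 1⟩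

instance : SetLike.GradedMonoid modTower where
  one_mem := mem_modTower.mpr ⟨1, one_ne_zero, isModular_one⟩
  mul_mem := by
    intro i j f g hf hg
    obtain ⟨N, hN, hf⟩ := mem_modTower.mp hf
    obtain ⟨M, hM, hg⟩ := mem_modTower.mp hg
    refine mem_modTower.mpr ⟨N * M, mul_ne_zero hN hM, ?_⟩
    push_cast
    exact (hf.mono (Dvd.intro M rfl)).mul (hg.mono (Dvd.intro_left N rfl))

/-- The modular tower `M = ⨁ₖ Mₖ`, a graded commutative `ℂ`-algebra. -/
def ModTower : Type := ⨁ k : ℕ, modTower k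

instance : CommRing ModTower := inferInstanceAs (CommRing (⨁ k : ℕ, modTower k))

instance : Algebra ℂ ModTower := inferInstanceAs (Algebra ℂ (⨁ k : ℕ, modTower k))

/-- The inclusion `Mₖ → M` of the component of weight `k`. -/
def ofM (k : ℕ) : modTower k →ₗ[ℂ] ModTower := DirectSum.lof ℂ ℕ (fun k => modTower k) k

/-! ### The quasimodular tower -/

/-- `f` is quasimodular of level `N`, weight `k` and depth at most `s`: there are holomorphic
`F 0, …, F s` with `(f|ₖγ)(z) = ∑ⱼ Fⱼ(z) (c/(cz+d))ʲ` for all `γ ∈ Γ(N)`, holomorphic at the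
cusps, i.e. `Fⱼ|_{k-2j} γ` is bounded at `i∞` for every `γ ∈ SL₂(ℤ)`.
Exact depth `s` means in addition `F s ≠ 0`; dropping vanishing top terms shows that "some exact
depth, or zero" is the same as "depth at most `s` for some `s`". -/
def IsQuasimodular (N k s : ℕ) (f : ℍ → ℂ) : Prop :=
  MDiff f ∧ ∃ F : ℕ → ℍ → ℂ,
    (∀ j ≤ s, MDiff (F j)) ∧
    (∀ j ≤ s, ∀ γ : SL(2, ℤ), IsBoundedAtImInfty (F j ∣[(k : ℤ) - 2 * j] γ)) ∧
    ∀ γ ∈ Gamma N, ∀ z : ℍ, (f ∣[(k : ℤ)] γ) z =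
      ∑ j ∈ Finset.range (s + 1), F j z * ((γ 1 0 : ℂ) / denom γ z) ^ j

/-- The same data with the coefficients extended by zero. -/
lemma IsQuasimodular.exists_ext {N k s : ℕ} {f : ℍ → ℂ} (hf : IsQuasimodular N k s f) :
    ∃ F : ℕ → ℍ → ℂ, (∀ j, MDiff (F j)) ∧
      (∀ j : ℕ, ∀ γ : SL(2, ℤ), IsBoundedAtImInfty (F j ∣[(k : ℤ) - 2 * j] γ)) ∧
      (∀ j, s < j → F j = 0) ∧
      ∀ t, s ≤ t → ∀ γ ∈ Gamma N, ∀ z : ℍ, (f ∣[(k : ℤ)] γ) z =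
        ∑ j ∈ Finset.range (t + 1), F j z * ((γ 1 0 : ℂ) / denom γ z) ^ j := by
  obtain ⟨_, F, h1, h2, h3⟩ := hf
  refine ⟨fun j => if j ≤ s then F j else 0, fun j => ?_, fun j γ => ?_, fun j hj => ?_,
    fun t ht γ hγ z => ?_⟩
  · dsimp only
    split_ifs with h
    · exact h1 j h
    · exact mdifferentiable_const
  · dsimp only
    split_ifs with h
    · exact h2 j h γ
    · rw [SlashAction.zero_slash]
      exact Filter.const_boundedAtFilter _ 0
  · simp [Nat.not_le.mpr hj]
  · rw [h3 γ hγ z]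
    have hsub : Finset.range (s + 1) ⊆ Finset.range (t + 1) :=
      Finset.range_subset_range.mpr (by lia)
    rw [← Finset.sum_subset hsub]
    · refine Finset.sum_congr rfl fun j hj => ?_
      dsimp only
      rw [if_pos (by simpa [Nat.lt_succ_iff] using hj)]
    · intro j _ hj
      dsimp only
      rw [if_neg (by simpa [Nat.lt_succ_iff] using hj)]
      simp

lemma IsQuasimodular.add {N M k s t : ℕ} {f g : ℍ → ℂ} (hf : IsQuasimodular N k s f)
    (hg : IsQuasimodular M k t g) : IsQuasimodular (N * M) k (max s t) (f + g) := by
  obtain ⟨F, hF1, hF2, -, hF⟩ := hf.exists_ext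
  obtain ⟨G, hG1, hG2, -, hG⟩ := hg.exists_ext
  refine ⟨hf.1.add hg.1, fun j => F j + G j, fun j _ => (hF1 j).add (hG1 j), fun j _ γ => ?_,
    fun γ hγ z => ?_⟩
  · rw [SlashAction.add_slash]
    exact (hF2 j γ).add (hG2 j γ)
  · rw [SlashAction.add_slash, Pi.add_apply,
      hF _ (le_max_left s t) γ (Gamma_le_of_dvd (Dvd.intro M rfl) hγ) z,
      hG _ (le_max_right s t) γ (Gamma_le_of_dvd (Dvd.intro_left N rfl) hγ) z,
      ← Finset.sum_add_distrib]
    exact Finset.sum_congr rfl fun j _ => by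
      dsimp only
      rw [Pi.add_apply, add_mul]

lemma IsQuasimodular.smul {N k s : ℕ} {f : ℍ → ℂ} (hf : IsQuasimodular N k s f) (c : ℂ) :
    IsQuasimodular N k s (c • f) := by
  obtain ⟨h0, F, h1, h2, h3⟩ := hf
  refine ⟨h0.const_smul c, fun j => c • F j, fun j hj => (h1 j hj).const_smul c,
    fun j hj γ => ?_, fun γ hγ z => ?_⟩
  · rw [ModularForm.SL_smul_slash]
    exact (h2 j hj γ).const_smul_left c
  · rw [ModularForm.SL_smul_slash, Pi.smul_apply, h3 γ hγ z, Finset.smul_sum]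
    exact Finset.sum_congr rfl fun j _ => by simp [mul_assoc]

open Polynomial in
lemma sum_mul_sum_pow (s t : ℕ) (a b : ℕ → ℂ) (ha : ∀ j, s < j → a j = 0)
    (hb : ∀ j, t < j → b j = 0) (x : ℂ) :
    (∑ j ∈ Finset.range (s + 1), a j * x ^ j) * (∑ j ∈ Finset.range (t + 1), b j * x ^ j) =
      ∑ n ∈ Finset.range (s + t + 1),
        (∑ p ∈ Finset.HasAntidiagonal.antidiagonal n, a p.1 * b p.2) * x ^ n := by
  set P : ℂ[X] := ∑ j ∈ Finset.range (s + 1), C (a j) * X ^ j with hP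
  set Q : ℂ[X] := ∑ j ∈ Finset.range (t + 1), C (b j) * X ^ j with hQ
  have cP : ∀ j, P.coeff j = a j := by
    intro j
    simp only [hP, finsetSum_coeff, coeff_C_mul_X_pow]
    by_cases hj : j < s + 1
    · simp [Finset.sum_ite_eq, hj]
    · rw [ha j (by lia)]
      exact Finset.sum_eq_zero fun i hi => if_neg (by rw [Finset.mem_range] at hi; lia)
  have cQ : ∀ j, Q.coeff j = b j := by
    intro j
    simp only [hQ, finsetSum_coeff, coeff_C_mul_X_pow]
    by_cases hj : j < t + 1
    · simp [Finset.sum_ite_eq, hj]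
    · rw [hb j (by lia)]
      exact Finset.sum_eq_zero fun i hi => if_neg (by rw [Finset.mem_range] at hi; lia)
  have dP : P.natDegree ≤ s := natDegree_le_iff_coeff_eq_zero.mpr fun j hj => by
    rw [cP, ha j hj]
  have dQ : Q.natDegree ≤ t := natDegree_le_iff_coeff_eq_zero.mpr fun j hj => by
    rw [cQ, hb j hj]
  have e1 : P.eval x = ∑ j ∈ Finset.range (s + 1), a j * x ^ j := by
    simp [hP, eval_finsetSum]
  have e2 : Q.eval x = ∑ j ∈ Finset.range (t + 1), b j * x ^ j := by
    simp [hQ, eval_finsetSum]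
  rw [← e1, ← e2, ← eval_mul, eval_eq_sum_range' (n := s + t + 1)]
  · refine Finset.sum_congr rfl fun n _ => ?_
    rw [coeff_mul]
    simp only [cP, cQ]
  · exact Nat.lt_succ_of_le (natDegree_mul_le.trans (add_le_add dP dQ))

lemma mdifferentiable_finset_sum {ι : Type*} (s : Finset ι) (f : ι → ℍ → ℂ)
    (h : ∀ i ∈ s, MDiff (f i)) : MDiff (∑ i ∈ s, f i) := by
  classical
  induction s using Finset.induction_on with
  | empty => simpa using! (mdifferentiable_const : MDiff (fun _ : ℍ => (0 : ℂ)))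
  | insert a s ha ih =>
    rw [Finset.sum_insert ha]
    exact (h a (by simp)).add (ih fun i hi => h i (by simp [hi]))

lemma isBoundedAtImInfty_finset_sum {ι : Type*} (s : Finset ι) (f : ι → ℍ → ℂ)
    (h : ∀ i ∈ s, IsBoundedAtImInfty (f i)) : IsBoundedAtImInfty (∑ i ∈ s, f i) := by
  classical
  induction s using Finset.induction_on with
  | empty => simpa using! Filter.const_boundedAtFilter atImInfty (0 : ℂ)
  | insert a s ha ih =>
    rw [Finset.sum_insert ha]
    exact (h a (by simp)).add (ih fun i hi => h i (by simp [hi]))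

lemma IsQuasimodular.mul {N M k l s t : ℕ} {f g : ℍ → ℂ} (hf : IsQuasimodular N k s f)
    (hg : IsQuasimodular M l t g) : IsQuasimodular (N * M) (k + l) (s + t) (f * g) := by
  obtain ⟨F, hF1, hF2, hF0, hF⟩ := hf.exists_ext
  obtain ⟨G, hG1, hG2, hG0, hG⟩ := hg.exists_ext
  refine ⟨hf.1.mul hg.1, fun n => ∑ p ∈ Finset.HasAntidiagonal.antidiagonal n, F p.1 * G p.2,
    fun n _ => mdifferentiable_finset_sum _ _ fun p _ => (hF1 _).mul (hG1 _),
    fun n _ γ => ?_, fun γ hγ z => ?_⟩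
  · rw [SlashAction.sum_slash]
    refine isBoundedAtImInfty_finset_sum _ _ fun p hp => ?_
    have hw : ((k + l : ℕ) : ℤ) - 2 * n = ((k : ℤ) - 2 * p.1) + ((l : ℤ) - 2 * p.2) := by
      rw [Finset.HasAntidiagonal.mem_antidiagonal] at hp
      rw [← hp]; push_cast; ring
    rw [hw, ModularForm.mul_slash_SL2]
    exact (hF2 _ γ).mul (hG2 _ γ)
  · rw [Nat.cast_add, ModularForm.mul_slash_SL2, Pi.mul_apply,
      hF s le_rfl γ (Gamma_le_of_dvd (Dvd.intro M rfl) hγ) z,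
      hG t le_rfl γ (Gamma_le_of_dvd (Dvd.intro_left N rfl) hγ) z,
      sum_mul_sum_pow s t (fun j => F j z) (fun j => G j z)
        (fun j hj => by simp [hF0 j hj]) (fun j hj => by simp [hG0 j hj])]
    exact Finset.sum_congr rfl fun n _ => by simp [Finset.sum_apply]

lemma IsModular.isQuasimodular {N k : ℕ} {f : ℍ → ℂ} (hf : IsModular N k f) :
    IsQuasimodular N k 0 f := by
  refine ⟨hf.2.1, fun _ => f, fun _ _ => hf.2.1, fun j hj γ => ?_, fun γ hγ z => ?_⟩
  · obtain rfl : j = 0 := by lia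
    simpa using hf.2.2 γ
  · rw [hf.1 γ hγ]; simp

/-- `QM_k`: functions on `ℍ` which are quasimodular forms of weight `k`, of some level `N ≥ 1`
and some depth. -/
def qmTower (k : ℕ) : Submodule ℂ (ℍ → ℂ) where
  carrier := {f | ∃ N : ℕ, N ≠ 0 ∧ ∃ s : ℕ, IsQuasimodular N k s f}
  zero_mem' := by
    obtain ⟨N, hN, h⟩ := mem_modTower.mp (modTower k).zero_mem
    exact ⟨N, hN, 0, h.isQuasimodular⟩
  add_mem' := by
    rintro f g ⟨N, hN, s, hf⟩ ⟨M, hM, t, hg⟩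
    exact ⟨N * M, mul_ne_zero hN hM, _, hf.add hg⟩
  smul_mem' := by
    rintro c f ⟨N, hN, s, hf⟩
    exact ⟨N, hN, s, hf.smul c⟩

lemma modTower_le_qmTower (k : ℕ) : modTower k ≤ qmTower k := by
  intro f hf
  obtain ⟨N, hN, h⟩ := mem_modTower.mp hf
  exact ⟨N, hN, 0, h.isQuasimodular⟩

instance : SetLike.GradedMonoid qmTower where
  one_mem := modTower_le_qmTower 0 SetLike.GradedOne.one_mem
  mul_mem := by
    rintro i j f g ⟨N, hN, s, hf⟩ ⟨M, hM, t, hg⟩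
    exact ⟨N * M, mul_ne_zero hN hM, _, hf.mul hg⟩

/-- The quasimodular tower `QM = ⨁ₖ QMₖ`, a graded commutative `ℂ`-algebra. -/
def QMTower : Type := ⨁ k : ℕ, qmTower k

instance : CommRing QMTower := inferInstanceAs (CommRing (⨁ k : ℕ, qmTower k))

instance : Algebra ℂ QMTower := inferInstanceAs (Algebra ℂ (⨁ k : ℕ, qmTower k))

/-- The inclusion `QMₖ → QM` of the component of weight `k`. -/
def ofQM (k : ℕ) : qmTower k →ₗ[ℂ] QMTower := DirectSum.lof ℂ ℕ (fun k => qmTower k) k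

lemma ofQM_mul {i j : ℕ} (f : qmTower i) (g : qmTower j) :
    ofQM i f * ofQM j g = ofQM (i + j) ⟨f * g, SetLike.GradedMul.mul_mem f.2 g.2⟩ :=
  by
  exact DirectSum.of_mul_of (A := fun k => qmTower k) f g

/-- Linear maps out of the modular tower, given weight by weight. -/
def liftM {V : Type*} [AddCommGroup V] [Module ℂ V] (φ : ∀ k, modTower k →ₗ[ℂ] V) :
    ModTower →ₗ[ℂ] V where
  toFun x := DirectSum.toModule ℂ ℕ V φ x
  map_add' x y := LinearMap.map_add (DirectSum.toModule ℂ ℕ V φ) x y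
  map_smul' c x := LinearMap.map_smul (DirectSum.toModule ℂ ℕ V φ) c x

lemma liftM_of {V : Type*} [AddCommGroup V] [Module ℂ V] (φ : ∀ k, modTower k →ₗ[ℂ] V) (k : ℕ)
    (f : modTower k) : liftM φ (ofM k f) = φ k f :=
  DirectSum.toModule_lof (φ := φ) ℂ k f

/-- The inclusion `M → QM` of the modular tower in the quasimodular tower. -/
def inclM : ModTower →ₗ[ℂ] QMTower :=
  liftM fun k => ofQM k ∘ₗ Submodule.inclusion (modTower_le_qmTower k)

/-! ### The Eisenstein series `G₂` and expansions in `G₂` -/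

/-- `G₂(z) = -B₂/4 + ∑_{n ≥ 1} (∑_{d ∣ n} d) e^{2πinz}`. -/
def G2 (z : ℍ) : ℂ :=
  -((bernoulli 2 : ℚ) : ℂ) / 4 +
    ∑' n : ℕ+, ((∑ d ∈ (n : ℕ).divisors, d : ℕ) : ℂ) * exp (2 * Real.pi * I * n * z)

lemma G2_eq : G2 = (-1 / 24 : ℂ) • EisensteinSeries.E2 := by
  ext z
  have h : ∀ n : ℕ+, ((∑ d ∈ (n : ℕ).divisors, d : ℕ) : ℂ) * exp (2 * Real.pi * I * n * z) =
      (ArithmeticFunction.sigma 1 n : ℂ) * exp (2 * Real.pi * I * z) ^ (n : ℕ) := by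
    intro n
    rw [ArithmeticFunction.sigma_one_apply, ← Complex.exp_nat_mul]
    congr 2
    ring
  rw [G2, tsum_congr h, Pi.smul_apply, EisensteinSeries.E2_eq_tsum_cexp, bernoulli_two,
    smul_eq_mul]
  push_cast
  ring

lemma E2_slash_apply (γ : SL(2, ℤ)) (z : ℍ) : (EisensteinSeries.E2 ∣[(2 : ℤ)] γ) z =
    EisensteinSeries.E2 z - 6 * I / Real.pi * ((γ 1 0 : ℂ) / denom γ z) := by
  rw [EisensteinSeries.E2_slash_action]
  have hpi : (Real.pi : ℂ) ≠ 0 := ofReal_ne_zero.mpr Real.pi_ne_zero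
  simp only [Pi.sub_apply, Pi.smul_apply, EisensteinSeries.D2, riemannZeta_two, smul_eq_mul]
  field_simp

lemma isBoundedAtImInfty_div_denom (γ : SL(2, ℤ)) :
    IsBoundedAtImInfty fun z : ℍ => (γ 1 0 : ℂ) / denom γ z := by
  rw [isBoundedAtImInfty_iff]
  refine ⟨1, 1, fun z hz => ?_⟩
  by_cases hc : γ 1 0 = 0
  · simp [hc]
  have h1 : |(γ 1 0 : ℝ)| * z.im ≤ ‖(denom γ z : ℂ)‖ := by
    have := abs_im_le_norm (denom γ z : ℂ)
    simpa [denom, abs_mul, abs_of_pos z.im_pos] using this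
  have h2 : |(γ 1 0 : ℝ)| ≤ ‖(denom γ z : ℂ)‖ :=
    le_trans (le_mul_of_one_le_right (abs_nonneg _) hz) h1
  rw [norm_div, norm_intCast]
  exact div_le_one_of_le₀ h2 (norm_nonneg _)

lemma isBoundedAtImInfty_G2_slash (γ : SL(2, ℤ)) : IsBoundedAtImInfty (G2 ∣[(2 : ℤ)] γ) := by
  rw [G2_eq, ModularForm.SL_smul_slash]
  have h : EisensteinSeries.E2 ∣[(2 : ℤ)] γ = EisensteinSeries.E2 -
      (6 * I / Real.pi) • fun z : ℍ => (γ 1 0 : ℂ) / denom γ z :=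
    funext fun z => E2_slash_apply γ z
  rw [h]
  have hb : IsBoundedAtImInfty (EisensteinSeries.E2 -
      (6 * I / Real.pi) • fun z : ℍ => (γ 1 0 : ℂ) / denom γ z) :=
    EisensteinSeries.isBoundedAtImInfty_E2.sub
      ((isBoundedAtImInfty_div_denom γ).const_smul_left _)
  exact hb.const_smul_left _

lemma isQuasimodular_G2 : IsQuasimodular 1 2 1 G2 := by
  have hG : MDiff G2 := by
    rw [G2_eq]
    exact E2_mdifferentiable.const_smul _
  refine ⟨hG, fun j => if j = 0 then G2 else fun _ => I / (4 * Real.pi), fun j _ => ?_,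
    fun j hj γ => ?_, fun γ _ z => ?_⟩
  · dsimp only
    split_ifs
    · exact hG
    · exact mdifferentiable_const
  · dsimp only
    split_ifs with h
    · subst h
      simpa using isBoundedAtImInfty_G2_slash γ
    · obtain rfl : j = 1 := by lia
      have e : ((fun _ => I / (4 * Real.pi) : ℍ → ℂ) ∣[((2 : ℕ) : ℤ) - 2 * ((1 : ℕ) : ℤ)] γ) =
          fun _ => I / (4 * Real.pi) :=
        ModularForm.is_invariant_const γ (I / (4 * Real.pi))
      rw [e]
      exact Filter.const_boundedAtFilter _ _
  · have hpi : (Real.pi : ℂ) ≠ 0 := ofReal_ne_zero.mpr Real.pi_ne_zero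
    have h : (G2 ∣[(2 : ℤ)] γ) z = G2 z + I / (4 * Real.pi) * ((γ 1 0 : ℂ) / denom γ z) := by
      rw [G2_eq, ModularForm.SL_smul_slash, Pi.smul_apply, E2_slash_apply, Pi.smul_apply,
        smul_eq_mul, smul_eq_mul]
      field_simp
      ring
    simpa [Finset.sum_range_succ] using h

lemma G2_mem : G2 ∈ qmTower 2 := ⟨1, one_ne_zero, 1, isQuasimodular_G2⟩

/-- `G₂` as an element of the quasimodular tower. -/
def G2' : QMTower := ofQM 2 ⟨G2, G2_mem⟩

/-- Evaluation of a polynomial `∑ᵢ aᵢ Tⁱ` with coefficients `aᵢ` in the modular tower at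
`T = G₂`. -/
def evalG2 : (ℕ →₀ ModTower) →ₗ[ℂ] QMTower :=
  Finsupp.lsum ℂ fun i =>
    { toFun := fun a => inclM a * G2' ^ i
      map_add' := fun a b => by rw [map_add, add_mul]
      map_smul' := fun c a => by
        rw [map_smul, RingHom.id_apply]
        exact Algebra.smul_mul_assoc c _ _ }

lemma exists_generalized_inverse {V W : Type*} [AddCommGroup V] [Module ℂ V] [AddCommGroup W]
    [Module ℂ W] (f : V →ₗ[ℂ] W) : ∃ e : W →ₗ[ℂ] V, f ∘ₗ e ∘ₗ f = f := by
  obtain ⟨g, hg⟩ := f.rangeRestrict.exists_rightInverse_of_surjective f.range_rangeRestrict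
  obtain ⟨e, he⟩ := g.exists_extend
  refine ⟨e, LinearMap.ext fun p => ?_⟩
  have h1 : e (f p) = g (f.rangeRestrict p) := LinearMap.congr_fun he (f.rangeRestrict p)
  have h2 := congrArg Subtype.val (LinearMap.congr_fun hg (f.rangeRestrict p))
  simpa [h1] using h2

/-- The coefficients `(aᵢ(f))ᵢ` of `f ∈ QM` in its expansion `f = ∑ᵢ aᵢ(f) G₂ⁱ`, `aᵢ(f) ∈ M`.
By the structure theorem for quasimodular forms every `f ∈ QM` has exactly one such expansion,
so that `evalG2` is bijective and `expansion` is its inverse. To avoid putting that theorem into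
the definition, `expansion` is defined as a linear map with `evalG2 ∘ expansion ∘ evalG2 =
evalG2`, which exists in any case. -/
def expansion : QMTower →ₗ[ℂ] (ℕ →₀ ModTower) := (exists_generalized_inverse evalG2).choose

/-- The operator `∑ᵢ aᵢ(f) G₂ⁱ ↦ ∑ᵢ T(aᵢ(f)) G₂ⁱ` on `QM` given by an operator `T` on `M`. -/
def extendToQM (T : ModTower →ₗ[ℂ] ModTower) : QMTower →ₗ[ℂ] QMTower :=
  evalG2 ∘ₗ Finsupp.mapRange.linearMap T ∘ₗ expansion

/-! ### The operations `‖α`, `α ∈ GL₂⁺(ℚ)` -/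

/-- The image in `GL₂(ℝ)` of an element of `GL₂⁺(ℚ)`. -/
def toReal (α : GL(2, ℚ)⁺) : GL (Fin 2) ℝ :=
  Matrix.GeneralLinearGroup.map (algebraMap ℚ ℝ) (α : GL (Fin 2) ℚ)

/-- `(f|ₖα)(z) = (cz+d)⁻ᵏ f((az+b)/(cz+d))`. -/
def slashFun (k : ℕ) (α : GL(2, ℚ)⁺) (f : ℍ → ℂ) (z : ℍ) : ℂ :=
  (denom (toReal α) z ^ k)⁻¹ * f (toReal α • z)

lemma toReal_det_pos (α : GL(2, ℚ)⁺) : 0 < (toReal α).det.val := by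
  have h : 0 < (α : GL (Fin 2) ℚ).det.val := α.2
  have h2 : (toReal α).det.val = (((α : GL (Fin 2) ℚ).det.val : ℚ) : ℝ) := by
    simp [toReal, Matrix.det_fin_two]
  rw [h2]
  exact_mod_cast h

lemma slashFun_eq (k : ℕ) (α : GL(2, ℚ)⁺) (f : ℍ → ℂ) :
    slashFun k α f =
      ((((toReal α).det.val : ℂ) ^ ((k : ℤ) - 1))⁻¹) • (f ∣[(k : ℤ)] toReal α) := by
  have h := toReal_det_pos α
  have h' : ((toReal α).det.val : ℂ) ^ ((k : ℤ) - 1) ≠ 0 :=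
    zpow_ne_zero _ (ofReal_ne_zero.mpr h.ne')
  ext z
  rw [Pi.smul_apply, ModularForm.slash_apply, σ, if_pos h, abs_of_pos h, smul_eq_mul, slashFun,
    zpow_neg, zpow_natCast, ContinuousAlgEquiv.refl_apply]
  field_simp

open Pointwise in
lemma slashFun_mem {k : ℕ} (α : GL(2, ℚ)⁺) {f : ℍ → ℂ} (hf : f ∈ modTower k) :
    slashFun k α f ∈ modTower k := by
  rw [slashFun_eq]
  refine (modTower k).smul_mem _ ?_
  obtain ⟨M, hM, g, rfl⟩ := hf
  have : NeZero M := ⟨hM⟩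
  obtain ⟨N, hN, hle⟩ := exists_Gamma_le_conj' (α : GL (Fin 2) ℚ) M
  have hle' : (Gamma N).map (mapGL ℝ) ≤
      ConjAct.toConjAct (toReal α)⁻¹ • (Gamma M).map (mapGL ℝ) := by
    intro x hx
    rw [Subgroup.mem_pointwise_smul_iff_inv_smul_mem, ← map_inv, inv_inv]
    exact hle (Subgroup.smul_mem_pointwise_smul _ _ _ hx)
  let t := ModularForm.translate g (toReal α)
  exact ⟨N, hN, ⟨⟨t, fun γ hγ => t.slash_action_eq' γ (hle' hγ)⟩, t.holo',
    fun hc => t.bdd_at_cusps' (hc.mono hle')⟩, rfl⟩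

/-- The action of `α` on the modular tower, `f ↦ f|ₖα` in weight `k`. -/
def slashM (α : GL(2, ℚ)⁺) : ModTower →ₗ[ℂ] ModTower :=
  liftM fun k => ofM k ∘ₗ
    { toFun := fun f => ⟨slashFun k α f, slashFun_mem α f.2⟩
      map_add' := fun _ _ => Subtype.ext <| funext fun _ => mul_add _ _ _
      map_smul' := fun _ _ => Subtype.ext <| funext fun _ => mul_left_comm _ _ _ }

/-- `f‖α = ∑ᵢ (aᵢ(f)|α) G₂ⁱ`. -/
def slashQM (α : GL(2, ℚ)⁺) : QMTower →ₗ[ℂ] QMTower := extendToQM (slashM α)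

/-! ### The operators `X` and `Y` -/

/-- `Δ(z) = (2π)¹² q ∏_{n ≥ 1} (1 - qⁿ)²⁴`, `q = e^{2πiz}`. -/
def Delta (z : ℂ) : ℂ :=
  (2 * Real.pi) ^ 12 * exp (2 * Real.pi * I * z) *
    ∏' n : ℕ, (1 - exp (2 * Real.pi * I * z) ^ (n + 1)) ^ 24

/-- `X(f) = (1/2πi) f' - (1/12πi) (d/dz log Δ) · (k/2) f` in weight `k`. -/
def XFun (k : ℕ) (f : ℍ → ℂ) (z : ℍ) : ℂ :=
  1 / (2 * Real.pi * I) * deriv (f ∘ ofComplex) z -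
    1 / (12 * Real.pi * I) * logDeriv Delta z * ((k / 2 : ℂ) * f z)

lemma Delta_eq (z : ℍ) : Delta z = (2 * Real.pi) ^ 12 * ModularForm.eta z ^ 24 := by
  have h := ModularForm.discriminant_eq_q_prod z
  simp only [ModularForm.discriminant, ModularForm.eta_q_eq_pow, Function.Periodic.qParam,
    ofReal_one, div_one] at h
  rw [h, Delta, mul_assoc]

lemma logDeriv_Delta (z : ℍ) :
    logDeriv Delta z = 2 * Real.pi * I * EisensteinSeries.E2 z := by
  have h : Delta =ᶠ[nhds (z : ℂ)] fun w => (2 * Real.pi : ℂ) ^ 12 * ModularForm.eta w ^ 24 := by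
    filter_upwards [isOpen_upperHalfPlaneSet.mem_nhds z.im_pos] with w hw
    exact Delta_eq ⟨w, hw⟩
  have hpi : (2 * Real.pi : ℂ) ^ 12 ≠ 0 := by
    simp [Real.pi_ne_zero]
  rw [logDeriv_apply, h.deriv_eq, h.eq_of_nhds, ← logDeriv_apply, logDeriv_const_mul _ _ hpi,
    logDeriv_fun_pow (ModularForm.differentiableAt_eta_of_mem_upperHalfPlaneSet z.im_pos),
    ModularForm.logDeriv_eta_eq_E2]
  push_cast
  ring

lemma XFun_eq (k : ℕ) (f : ℍ → ℂ) : XFun k f = Derivative.serreDerivative k f := by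
  ext z
  have hpi : (Real.pi : ℂ) ≠ 0 := ofReal_ne_zero.mpr Real.pi_ne_zero
  rw [XFun, logDeriv_Delta, Derivative.serreDerivative_apply,
    Derivative.normalizedDerivOfComplex]
  field_simp

lemma isBoundedAtImInfty_D {f : ℍ → ℂ} (hf : MDiff f) (hb : IsBoundedAtImInfty f) :
    IsBoundedAtImInfty (Derivative.normalizedDerivOfComplex f) := by
  rw [isBoundedAtImInfty_iff] at hb ⊢
  obtain ⟨M, A, h⟩ := hb
  refine ⟨‖(2 * Real.pi * I : ℂ)⁻¹‖ * M, max A 1 + 1, fun z hz => ?_⟩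
  rw [Derivative.normalizedDerivOfComplex, norm_mul]
  refine mul_le_mul_of_nonneg_left ?_ (norm_nonneg _)
  have key : ∀ w ∈ Metric.closedBall (z : ℂ) 1, max A 1 ≤ w.im := by
    intro w hw
    rw [Metric.mem_closedBall, Complex.dist_eq] at hw
    have h1 := (abs_im_le_norm (w - z)).trans hw
    rw [sub_im, abs_le] at h1
    have h2 : (z : ℂ).im = z.im := rfl
    linarith [h1.1]
  have hpos : ∀ w ∈ Metric.closedBall (z : ℂ) 1, 0 < w.im := fun w hw =>
    lt_of_lt_of_le (lt_of_lt_of_le one_pos (le_max_right A 1)) (key w hw)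
  have hd : DiffContOnCl ℂ (f ∘ ofComplex) (Metric.ball (z : ℂ) 1) := by
    refine DifferentiableOn.diffContOnCl_ball (U := upperHalfPlaneSet) ?_ hpos
    exact UpperHalfPlane.mdifferentiable_iff.mp hf
  have := norm_deriv_le_of_forall_mem_sphere_norm_le (C := M) one_pos hd fun w hw => ?_
  · simpa using this
  · have hw' := Metric.sphere_subset_closedBall hw
    rw [Function.comp_apply, ofComplex_apply_of_im_pos (hpos w hw')]
    exact h _ ((le_max_left A 1).trans (key w hw'))

lemma XFun_mem {k : ℕ} {f : ℍ → ℂ} (hf : f ∈ modTower k) : XFun k f ∈ modTower (k + 2) := by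
  obtain ⟨N, hN, h1, h2, h3⟩ := mem_modTower.mp hf
  rw [XFun_eq]
  refine mem_modTower.mpr ⟨N, hN, fun γ hγ => ?_,
    Derivative.serreDerivative_mdifferentiable _ h2, fun γ => ?_⟩
  · have := Derivative.serreDerivative_slash_equivariant (k := k) h2 (γ := γ)
    rw [h1 γ hγ] at this
    exact_mod_cast this
  · have := Derivative.serreDerivative_slash_equivariant (k := k) h2 (γ := γ)
    have hb : IsBoundedAtImInfty
        (Derivative.serreDerivative ((k : ℤ) : ℂ) (f ∣[(k : ℤ)] γ)) := by
      have e : Derivative.serreDerivative ((k : ℤ) : ℂ) (f ∣[(k : ℤ)] γ) =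
          Derivative.normalizedDerivOfComplex (f ∣[(k : ℤ)] γ) -
            (((k : ℤ) : ℂ) * 12⁻¹) • (EisensteinSeries.E2 * (f ∣[(k : ℤ)] γ)) := by
        ext z
        simp [mul_assoc]
      rw [e]
      exact (isBoundedAtImInfty_D (h2.slash _ _) (h3 γ)).sub
        ((EisensteinSeries.isBoundedAtImInfty_E2.mul (h3 γ)).const_smul_left _)
    rw [← this] at hb
    exact_mod_cast hb

lemma mdiff_of_mem {k : ℕ} {f : ℍ → ℂ} (hf : f ∈ modTower k) : MDiff f := by
  obtain ⟨N, -, h⟩ := mem_modTower.mp hf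
  exact h.2.1

/-- `X : Mₖ → Mₖ₊₂` on the modular tower. -/
def XM : ModTower →ₗ[ℂ] ModTower :=
  liftM fun k => ofM (k + 2) ∘ₗ
      { toFun := fun f => ⟨XFun k f, XFun_mem f.2⟩
        map_add' := fun f g => Subtype.ext <| by
          simp only [XFun_eq, Submodule.coe_add]
          exact Derivative.serreDerivative_add _ _ _ (mdiff_of_mem f.2) (mdiff_of_mem g.2)
        map_smul' := fun c f => Subtype.ext <| by
          simp only [XFun_eq, Submodule.coe_smul, RingHom.id_apply]
          exact Derivative.serreDerivative_smul _ _ _ (mdiff_of_mem f.2) }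

/-- `Y : Mₖ → Mₖ`, `Y(f) = (k/2) f`. -/
def YM : ModTower →ₗ[ℂ] ModTower :=
  liftM fun k => (k / 2 : ℂ) • ofM k

/-- `X(f) = ∑ᵢ X(aᵢ(f)) G₂ⁱ` on the quasimodular tower. -/
def XQM : QMTower →ₗ[ℂ] QMTower := extendToQM XM

/-- `Y(f) = ∑ᵢ Y(aᵢ(f)) G₂ⁱ` on the quasimodular tower. -/
def YQM : QMTower →ₗ[ℂ] QMTower := extendToQM YM

/-! ### Twisted quasimodular Hecke operators -/

/-- The inclusion `SL₂(ℤ) → GL₂⁺(ℚ)`. -/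
def slToGL : SL(2, ℤ) →* GL(2, ℚ)⁺ :=
  toGLPos.comp (Matrix.SpecialLinearGroup.map (Int.castRingHom ℚ))

/-- The set `Γ(N) \ GL₂⁺(ℚ)` of cosets `Γ(N)α`. -/
abbrev Cosets (N : ℕ) : Type :=
  Quotient (QuotientGroup.rightRel ((Gamma N).map slToGL))

/-- The coset `Γ(N)α`. -/
def coset (N : ℕ) (α : GL(2, ℚ)⁺) : Cosets N :=
  Quotient.mk (QuotientGroup.rightRel ((Gamma N).map slToGL)) α

/-- `Q_σ(Γ(N))`: functions `F : Γ(N) \ GL₂⁺(ℚ) → QM` of finite support with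
`F_{αγ} = F_α ‖ σγσ⁻¹` for `γ ∈ Γ(N)`. -/
def Qtw (N : ℕ) (σ : SL(2, ℤ)) : Submodule ℂ (Cosets N → QMTower) where
  carrier := {F | F.support.Finite ∧ ∀ γ ∈ Gamma N, ∀ α : GL(2, ℚ)⁺,
    F (coset N (α * slToGL γ)) = slashQM (slToGL (σ * γ * σ⁻¹)) (F (coset N α))}
  zero_mem' := ⟨by simp, fun γ _ α => by simp⟩
  add_mem' := fun hF hG => ⟨(hF.1.union hG.1).subset (Function.support_add _ _),
    fun γ hγ α => by
      rw [Pi.add_apply, Pi.add_apply, hF.2 γ hγ α, hG.2 γ hγ α, map_add]⟩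
  smul_mem' := fun c F hF => ⟨hF.1.subset (Function.support_const_smul_subset c F),
    fun γ hγ α => by rw [Pi.smul_apply, Pi.smul_apply, hF.2 γ hγ α, map_smul]⟩

/-- The value `F_α ∈ QM`. -/
def valueAt {N : ℕ} {σ : SL(2, ℤ)} (F : Qtw N σ) (α : GL(2, ℚ)⁺) : QMTower :=
  (F : Cosets N → QMTower) (coset N α)

/-- The set `Γ(N) \ SL₂(ℤ)`. -/
abbrev SLCosets (N : ℕ) : Type := Quotient (QuotientGroup.rightRel (Gamma N))

/-- `∑_β F¹_{βσ} · (F²_{ασ⁻¹β⁻¹} ‖ σβ)`, where `β = r q` runs over a system `r` of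
representatives of the finitely many cosets `q ∈ Γ(N) \ SL₂(ℤ)`. -/
def pairingFormula {N : ℕ} {σ : SL(2, ℤ)} (r : SLCosets N → SL(2, ℤ)) (F₁ F₂ : Qtw N σ)
    (α : GL(2, ℚ)⁺) : QMTower :=
  ∑ᶠ q : SLCosets N, valueAt F₁ (slToGL (r q * σ)) *
    slashQM (slToGL (σ * r q)) (valueAt F₂ (α * slToGL (σ⁻¹ * (r q)⁻¹)))

/-! ### The Lie algebra `l₁` and its enveloping algebra -/

/-- The Lie algebra `l₁` over `ℂ`, with basis `X = (1, 0)`, `Y = (0, 1)` and `[Y, X] = X`. -/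
def L1 : Type := ℂ × ℂ

instance : AddCommGroup L1 := inferInstanceAs (AddCommGroup (ℂ × ℂ))

instance : Module ℂ L1 := inferInstanceAs (Module ℂ (ℂ × ℂ))

/-- The generator `X`. -/
def L1.X : L1 := ((1 : ℂ), (0 : ℂ))

/-- The generator `Y`. -/
def L1.Y : L1 := ((0 : ℂ), (1 : ℂ))

instance : Bracket L1 L1 where
  bracket u v := (u.2 * v.1 - u.1 * v.2, (0 : ℂ))

lemma L1.lie_fst (u v : L1) : ⁅u, v⁆.1 = u.2 * v.1 - u.1 * v.2 := rfl

lemma L1.lie_snd (u v : L1) : ⁅u, v⁆.2 = 0 := rfl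

lemma L1.ext' {u v : L1} (h1 : u.1 = v.1) (h2 : u.2 = v.2) : u = v := Prod.ext h1 h2

lemma L1.add_fst (u v : L1) : (u + v).1 = u.1 + v.1 := rfl

lemma L1.add_snd (u v : L1) : (u + v).2 = u.2 + v.2 := rfl

lemma L1.smul_fst (c : ℂ) (u : L1) : (c • u).1 = c * u.1 := rfl

lemma L1.smul_snd (c : ℂ) (u : L1) : (c • u).2 = c * u.2 := rfl

instance : LieRing L1 where
  add_lie u v w := by
    refine L1.ext' ?_ ?_ <;> simp only [L1.lie_fst, L1.lie_snd, L1.add_fst, L1.add_snd] <;> ring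
  lie_add u v w := by
    refine L1.ext' ?_ ?_ <;> simp only [L1.lie_fst, L1.lie_snd, L1.add_fst, L1.add_snd] <;> ring
  lie_self u := by
    refine L1.ext' ?_ rfl
    show u.2 * u.1 - u.1 * u.2 = 0
    ring
  leibniz_lie u v w := by
    refine L1.ext' ?_ ?_ <;> simp only [L1.lie_fst, L1.lie_snd, L1.add_fst, L1.add_snd] <;> ring

instance : LieAlgebra ℂ L1 where
  lie_smul c u v := by
    refine L1.ext' ?_ ?_ <;> simp only [L1.lie_fst, L1.lie_snd, L1.smul_fst, L1.smul_snd] <;> ring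

lemma L1.lie_Y_X : ⁅L1.Y, L1.X⁆ = L1.X := by
  refine L1.ext' ?_ rfl
  show (1 : ℂ) * 1 - 0 * 0 = 1
  norm_num

/-- The enveloping algebra `h₁ = U(l₁)`. -/
abbrev H1 : Type := UniversalEnvelopingAlgebra ℂ L1

/-- The coproduct `Δ : h₁ → h₁ ⊗ h₁`, the algebra map with `Δ(u) = u ⊗ 1 + 1 ⊗ u` for
`u ∈ l₁`. -/
def coproduct : H1 →ₐ[ℂ] H1 ⊗[ℂ] H1 :=
  UniversalEnvelopingAlgebra.lift ℂ
    { toFun := fun u => UniversalEnvelopingAlgebra.ι ℂ u ⊗ₜ[ℂ] (1 : H1) +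
        (1 : H1) ⊗ₜ[ℂ] UniversalEnvelopingAlgebra.ι ℂ u
      map_add' := fun u v => by
        simp only [map_add, TensorProduct.add_tmul, TensorProduct.tmul_add]
        abel
      map_smul' := fun c u => by
        simp only [map_smul, TensorProduct.smul_tmul', TensorProduct.tmul_smul, smul_add,
          RingHom.id_apply]
      map_lie' := fun {u v} => by
        simp only [LieHom.map_lie, LieRing.of_associative_ring_bracket, TensorProduct.sub_tmul,
          TensorProduct.tmul_sub, add_mul, mul_add, Algebra.TensorProduct.tmul_mul_tmul, one_mul,
          mul_one]
        abel }

end QMHecke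

end

/-!
An expansion in powers of `G₂` with modular coefficients is unique, because at a fixed point of the
upper half plane the functions `G₂|γ` take infinitely many values as `γ` varies in `Γ(N)`. It
exists for every quasimodular form: the law `G₂|γ = G₂ + κ · c / (cz + d)` turns the defining
expansion in powers of `c / (cz + d)` into one in powers of `G₂|γ`, whose coefficients are
invariant by the same uniqueness and can be read off at `γ = 1`. So `QM` is the polynomial algebra
`M[G₂]`. The slash operators are multiplicative on `M`, and `X` and `Y` are derivations of `M` (`X`
is the Serre derivative) which commute with the slash operators of `SL₂(ℤ)`; since `G₂` is a
constant for all of them, these properties carry over to `QM`.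

The summand of the pairing at `β` depends only on the coset of `β`, by the twisted equivariance of
`F²`, and the substitution `β ↦ β σγσ⁻¹` gives the equivariance of the sum. Since `X` and `Y` are
derivations commuting with the operations `‖σβ`, they act as derivations of the pairing. Finally,
the elements of `h₁` which act compatibly with the coproduct form a subalgebra, which contains the
generating set `l₁`.
-/

noncomputable section

namespace QMHecke

/-! ### Expansions in powers of `G₂` -/

/-- The constant `κ` in the transformation law `G₂|γ = G₂ + κ · c / (cz + d)`. -/
def g2Anomaly : ℂ := I / (4 * Real.pi)

lemma g2Anomaly_ne_zero : g2Anomaly ≠ 0 := by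
  simp [g2Anomaly, Real.pi_ne_zero]

lemma G2_slash_apply (γ : SL(2, ℤ)) (z : ℍ) :
    (G2 ∣[(2 : ℤ)] γ) z = G2 z + g2Anomaly * ((γ 1 0 : ℂ) / denom γ z) := by
  have hpi : (Real.pi : ℂ) ≠ 0 := ofReal_ne_zero.mpr Real.pi_ne_zero
  rw [G2_eq, ModularForm.SL_smul_slash, Pi.smul_apply, E2_slash_apply, Pi.smul_apply,
    smul_eq_mul, smul_eq_mul, g2Anomaly]
  field_simp
  ring

lemma infinite_image_div_denom {N : ℕ} (hN : N ≠ 0) (z : ℍ) :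
    ((fun γ : SL(2, ℤ) => (γ 1 0 : ℂ) / denom γ z) '' Gamma N).Infinite := by
  let u : ℕ → SL(2, ℤ) := fun m => ⟨!![1, 0; (m * N : ℤ), 1], by simp [Matrix.det_fin_two]⟩
  have hu : ∀ m, u m ∈ Gamma N := fun m => by
    rw [Gamma_mem]
    simp [u]
  have denom_u : ∀ m, denom (u m) z = (m * N : ℂ) * z + 1 := fun m => by
    rw [ModularGroup.denom_apply]
    simp [u]
  have hne : ∀ m : ℕ, (m * N : ℂ) * z + 1 ≠ 0 := fun m => denom_u m ▸ denom_ne_zero _ z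
  have hinj : Function.Injective fun m => (u m 1 0 : ℂ) / denom (u m) z := by
    intro m n h
    simp only [denom_u, div_eq_div_iff (hne m) (hne n)] at h
    have hmn : (m * N : ℂ) = n * N := by
      have h' : (m * N : ℂ) * (n * N * z + 1) = n * N * (m * N * z + 1) := by simpa [u] using h
      linear_combination h'
    exact_mod_cast mul_right_cancel₀ (Nat.cast_ne_zero.mpr hN) hmn
  refine (Set.infinite_range_of_injective hinj).mono ?_
  rintro _ ⟨m, rfl⟩
  exact ⟨u m, hu m, rfl⟩

lemma infinite_image_G2_slash_apply {N : ℕ} (hN : N ≠ 0) (z : ℍ) :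
    ((fun γ : SL(2, ℤ) => (G2 ∣[(2 : ℤ)] γ) z) '' Gamma N).Infinite := by
  have hinj : Function.Injective fun x => G2 z + g2Anomaly * x :=
    (add_right_injective _).comp (mul_right_injective₀ g2Anomaly_ne_zero)
  simpa only [Set.image_image, ← G2_slash_apply] using
    (infinite_image_div_denom hN z).image hinj.injOn

lemma eq_of_sum_mul_pow_eq_of_infinite {R : Type*} [CommRing R] [IsDomain R] {S : Set R}
    (hS : S.Infinite) {n : ℕ} {a b : ℕ → R}
    (h : ∀ x ∈ S, ∑ i ∈ Finset.range n, a i * x ^ i = ∑ i ∈ Finset.range n, b i * x ^ i) :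
    ∀ i < n, a i = b i := by
  intro i hi
  have key : (∑ i ∈ Finset.range n, Polynomial.C (a i) * Polynomial.X ^ i) =
      ∑ i ∈ Finset.range n, Polynomial.C (b i) * Polynomial.X ^ i :=
    Polynomial.eq_of_infinite_eval_eq _ _ <| hS.mono fun x hx => by
      simpa [Polynomial.eval_finsetSum] using h x hx
  simpa [Polynomial.finsetSum_coeff, Polynomial.coeff_X_pow, hi] using
    congrArg (Polynomial.coeff · i) key

lemma eq_of_sum_mul_G2_slash_pow_eq {N n : ℕ} (hN : N ≠ 0) {g h : ℕ → ℍ → ℂ}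
    (hgh : ∀ γ ∈ Gamma N, ∑ i ∈ Finset.range n, g i * (G2 ∣[(2 : ℤ)] γ) ^ i =
      ∑ i ∈ Finset.range n, h i * (G2 ∣[(2 : ℤ)] γ) ^ i) :
    ∀ i < n, g i = h i := by
  intro i hi
  ext z
  refine eq_of_sum_mul_pow_eq_of_infinite (a := fun i => g i z) (b := fun i => h i z)
    (infinite_image_G2_slash_apply hN z) ?_ i hi
  rintro _ ⟨γ, hγ, rfl⟩
  simpa using congrFun (hgh γ hγ) z

lemma mul_pow_slash (k l : ℤ) (g h : ℍ → ℂ) (i : ℕ) (γ : SL(2, ℤ)) :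
    (g * h ^ i) ∣[k] γ = (g ∣[k - l * i] γ) * (h ∣[l] γ) ^ i := by
  induction i generalizing g with
  | zero => simp
  | succ i ih =>
    have hk : k - l * i = (k - l * (i + 1 : ℕ)) + l := by
      push_cast
      ring
    rw [pow_succ', ← mul_assoc, ih, hk, ModularForm.mul_slash_SL2, mul_assoc, ← pow_succ']

lemma eq_zero_of_sum_mul_G2_pow_eq_zero {N n : ℕ} {k : ℤ} (hN : N ≠ 0) {g : ℕ → ℍ → ℂ}
    (hg : ∀ i < n, ∀ γ ∈ Gamma N, g i ∣[k - 2 * i] γ = g i)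
    (h : ∑ i ∈ Finset.range n, g i * G2 ^ i = 0) : ∀ i < n, g i = 0 := by
  refine eq_of_sum_mul_G2_slash_pow_eq hN (h := 0) fun γ hγ => ?_
  have hslash := congrArg (· ∣[k] γ) h
  simp only [SlashAction.zero_slash, SlashAction.sum_slash, mul_pow_slash k 2] at hslash
  simp only [Pi.zero_apply, zero_mul, Finset.sum_const_zero]
  rw [← hslash]
  exact Finset.sum_congr rfl fun i hi => by rw [hg i (Finset.mem_range.mp hi) γ hγ]

/-- The coefficient of `G₂ⁱ` in the expansion of a quasimodular form of depth at most `s` with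
coefficient functions `F 0, …, F s`. It is obtained by substituting
`c / (cz + d) = κ⁻¹ (G₂|γ - G₂)` in `∑ⱼ Fⱼ (c / (cz + d))ʲ` and collecting powers of `G₂|γ`. -/
def G2Coeff (s : ℕ) (F : ℕ → ℍ → ℂ) (i : ℕ) : ℍ → ℂ :=
  ∑ j ∈ Finset.Icc i s, (g2Anomaly⁻¹ ^ j * j.choose i) • (F j * (-G2) ^ (j - i))

lemma sum_G2Coeff_mul_pow (s : ℕ) (F : ℕ → ℍ → ℂ) (z : ℍ) (x : ℂ) :
    ∑ i ∈ Finset.range (s + 1), G2Coeff s F i z * (G2 z + g2Anomaly * x) ^ i =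
      ∑ j ∈ Finset.range (s + 1), F j z * x ^ j := by
  set y := G2 z + g2Anomaly * x with hy
  have hx : x = g2Anomaly⁻¹ * (y + -G2 z) := by
    rw [hy, add_neg_cancel_comm, inv_mul_cancel_left₀ g2Anomaly_ne_zero]
  simp only [G2Coeff, Finset.sum_apply, Finset.sum_mul, Pi.smul_apply, Pi.mul_apply, Pi.pow_apply,
    Pi.neg_apply, smul_eq_mul]
  rw [Finset.sum_comm' (t' := Finset.range (s + 1)) (s' := fun j => Finset.range (j + 1))]
  · refine Finset.sum_congr rfl fun j _ => ?_
    rw [hx, mul_pow, add_pow, Finset.mul_sum, Finset.mul_sum]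
    exact Finset.sum_congr rfl fun i _ => by ring
  · intro i j
    simp only [Finset.mem_range, Finset.mem_Icc]
    lia

lemma mdiff_G2Coeff {s : ℕ} {F : ℕ → ℍ → ℂ} (hF : ∀ j ≤ s, MDiff (F j)) (i : ℕ) :
    MDiff (G2Coeff s F i) :=
  mdifferentiable_finset_sum _ _ fun j hj =>
    ((hF j (Finset.mem_Icc.mp hj).2).mul (isQuasimodular_G2.1.neg.pow _)).const_smul _

lemma isBoundedAtImInfty_G2Coeff_slash {s : ℕ} {k : ℤ} {F : ℕ → ℍ → ℂ} {γ : SL(2, ℤ)}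
    (hF : ∀ j ≤ s, IsBoundedAtImInfty (F j ∣[k - 2 * j] γ)) (i : ℕ) :
    IsBoundedAtImInfty (G2Coeff s F i ∣[k - 2 * i] γ) := by
  rw [G2Coeff, SlashAction.sum_slash]
  refine isBoundedAtImInfty_finset_sum _ _ fun j hj => ?_
  obtain ⟨hij, hjs⟩ := Finset.mem_Icc.mp hj
  have hweight : k - 2 * i - 2 * (j - i : ℕ) = k - 2 * j := by
    push_cast [hij]
    ring
  have hG2 : IsBoundedAtImInfty ((-G2) ∣[(2 : ℤ)] γ) := by
    rw [SlashAction.neg_slash]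
    exact (isBoundedAtImInfty_G2_slash γ).neg_left
  rw [ModularForm.SL_smul_slash, mul_pow_slash _ 2, hweight]
  exact ((hF j hjs).mul
    (pow_mem (S := boundedAtImInftySubalgebra ℂ) hG2 _)).const_smul_left _

lemma G2Coeff_slash_eq {N k s : ℕ} (hN : N ≠ 0) {f : ℍ → ℂ} {F : ℕ → ℍ → ℂ}
    (hf : ∀ γ ∈ Gamma N,
      f ∣[(k : ℤ)] γ = ∑ i ∈ Finset.range (s + 1), G2Coeff s F i * (G2 ∣[(2 : ℤ)] γ) ^ i)
    {δ : SL(2, ℤ)} (hδ : δ ∈ Gamma N) {i : ℕ} (hi : i ≤ s) :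
    G2Coeff s F i ∣[(k : ℤ) - 2 * i] δ = G2Coeff s F i := by
  refine eq_of_sum_mul_G2_slash_pow_eq (g := fun i => G2Coeff s F i ∣[(k : ℤ) - 2 * i] δ) hN
    (fun γ hγ => ?_) i (Nat.lt_succ_of_le hi)
  have hslash := congrArg (· ∣[(k : ℤ)] δ) (hf _ (mul_mem hγ (inv_mem hδ)))
  simp only [SlashAction.sum_slash, mul_pow_slash _ 2, ← SlashAction.slash_mul,
    inv_mul_cancel_right] at hslash
  rw [← hslash, hf γ hγ]

theorem IsQuasimodular.exists_eq_sum_mul_G2_pow {N k s : ℕ} (hN : N ≠ 0) {f : ℍ → ℂ}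
    (hf : IsQuasimodular N k s f) :
    ∃ g : ℕ → ℍ → ℂ, (∀ i ≤ s, IsModular N ((k : ℤ) - 2 * i) (g i)) ∧
      f = ∑ i ∈ Finset.range (s + 1), g i * G2 ^ i := by
  obtain ⟨-, F, hdiff, hbdd, hF⟩ := hf
  have hslash : ∀ γ ∈ Gamma N, f ∣[(k : ℤ)] γ =
      ∑ i ∈ Finset.range (s + 1), G2Coeff s F i * (G2 ∣[(2 : ℤ)] γ) ^ i := by
    intro γ hγ
    ext z
    simp only [hF γ hγ z, Finset.sum_apply, Pi.mul_apply, Pi.pow_apply, G2_slash_apply,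
      sum_G2Coeff_mul_pow]
  refine ⟨G2Coeff s F, fun i hi => ⟨fun δ hδ => G2Coeff_slash_eq hN hslash hδ hi,
    mdiff_G2Coeff hdiff i, fun γ => isBoundedAtImInfty_G2Coeff_slash (fun j hj => hbdd j hj γ) i⟩,
    ?_⟩
  simpa using hslash 1 (one_mem _)

lemma IsModular.eq_zero_of_neg {N : ℕ} (hN : N ≠ 0) {k : ℤ} (hk : k < 0) {f : ℍ → ℂ}
    (hf : IsModular N k f) : f = 0 := by
  have : NeZero N := ⟨hN⟩
  obtain ⟨g, rfl⟩ := (exists_modularForm_iff hN).mpr hf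
  rw [ModularForm.isZero_of_neg_weight hk g]
  rfl

/-! ### Linear maps on algebras, checked on a spanning family -/

section SpanningFamily

variable {R A B ι : Type*} [CommSemiring R] [Semiring A] [Algebra R A] [Semiring B] [Algebra R B]
  {v : ι → A}

lemma map_mul_of_span_eq_top (hv : Submodule.span R (Set.range v) = ⊤) {T : A →ₗ[R] B}
    (hT : ∀ i j, T (v i * v j) = T (v i) * T (v j)) (a b : A) : T (a * b) = T a * T b := by
  have key : (LinearMap.mul R A).compr₂ T = (LinearMap.mul R B).compl₁₂ T T :=
    LinearMap.ext_on_range hv fun i => LinearMap.ext_on_range hv fun j => hT i j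
  exact LinearMap.congr_fun₂ key a b

lemma leibniz_of_span_eq_top (hv : Submodule.span R (Set.range v) = ⊤) {T : A →ₗ[R] A}
    (hT : ∀ i j, T (v i * v j) = T (v i) * v j + v i * T (v j)) (a b : A) :
    T (a * b) = T a * b + a * T b := by
  have key : (LinearMap.mul R A).compr₂ T =
      (LinearMap.mul R A).comp T + (LinearMap.mul R A).compl₂ T :=
    LinearMap.ext_on_range hv fun i => LinearMap.ext_on_range hv fun j => hT i j
  exact LinearMap.congr_fun₂ key a b

end SpanningFamily

/-! ### The structure theorem -/

lemma ofM_mul {i j : ℕ} (f : modTower i) (g : modTower j) :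
    ofM i f * ofM j g = ofM (i + j) ⟨f * g, SetLike.GradedMul.mul_mem f.2 g.2⟩ :=
  DirectSum.of_mul_of (A := fun k => modTower k) f g

lemma ofM_congr {i j : ℕ} (h : i = j) {f : modTower i} {g : modTower j}
    (hfg : (f : ℍ → ℂ) = g) : ofM i f = ofM j g := by
  subst h
  rw [Subtype.ext hfg]

lemma iSup_range_ofM : ⨆ k, LinearMap.range (ofM k) = ⊤ :=
  DFinsupp.iSup_range_lsingle

lemma span_range_ofM :
    Submodule.span ℂ (Set.range fun p : Σ k, modTower k => ofM p.1 p.2) = ⊤ := by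
  rw [eq_top_iff, ← iSup_range_ofM, iSup_le_iff]
  rintro k _ ⟨f, rfl⟩
  exact Submodule.subset_span ⟨⟨k, f⟩, rfl⟩

lemma iSup_range_ofQM : ⨆ k, LinearMap.range (ofQM k) = ⊤ :=
  DFinsupp.iSup_range_lsingle

lemma inclM_of (k : ℕ) (f : modTower k) :
    inclM (ofM k f) = ofQM k ⟨f, modTower_le_qmTower k f.2⟩ :=
  liftM_of _ k f

lemma inclM_mul (a b : ModTower) : inclM (a * b) = inclM a * inclM b := by
  refine map_mul_of_span_eq_top span_range_ofM (fun p q => ?_) a b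
  rw [ofM_mul, inclM_of, inclM_of, inclM_of, ofQM_mul]

lemma mul_G2_pow_mem {k : ℕ} {f : ℍ → ℂ} (hf : f ∈ modTower k) (i : ℕ) :
    f * G2 ^ i ∈ qmTower (k + 2 * i) := by
  induction i with
  | zero => simpa using modTower_le_qmTower k hf
  | succ i ih =>
    rw [pow_succ, ← mul_assoc]
    exact SetLike.GradedMul.mul_mem (A := qmTower) (i := k + 2 * i) (j := 2) ih G2_mem

lemma inclM_of_mul_G2'_pow (k : ℕ) (f : modTower k) (i : ℕ) :
    inclM (ofM k f) * G2' ^ i = ofQM (k + 2 * i) ⟨f * G2 ^ i, mul_G2_pow_mem f.2 i⟩ := by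
  induction i with
  | zero =>
    rw [pow_zero, mul_one, inclM_of]
    exact congrArg (ofQM k) (Subtype.ext (by simp))
  | succ i ih =>
    rw [pow_succ, ← mul_assoc, ih, G2', ofQM_mul]
    exact congrArg (ofQM (k + 2 * i + 2)) (Subtype.ext (by simp [pow_succ, mul_assoc]))

/-- The component of weight `k` of an element of the modular tower. Weights range over `ℤ`, the
components of negative weight being zero, so that they can be shifted without truncation. -/
def compM : ℤ → ModTower →ₗ[ℂ] (ℍ → ℂ)
  | Int.ofNat k => (modTower k).subtype ∘ₗ DirectSum.component ℂ ℕ (fun k => modTower k) k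
  | Int.negSucc _ => 0

/-- The component of weight `k ∈ ℤ` of an element of the quasimodular tower, as in `compM`. -/
def compQM : ℤ → QMTower →ₗ[ℂ] (ℍ → ℂ)
  | Int.ofNat k => (qmTower k).subtype ∘ₗ DirectSum.component ℂ ℕ (fun k => qmTower k) k
  | Int.negSucc _ => 0

lemma compM_of (k : ℤ) (l : ℕ) (f : modTower l) :
    compM k (ofM l f) = if (l : ℤ) = k then (f : ℍ → ℂ) else 0 := by
  split_ifs with h
  · subst h
    exact congrArg Subtype.val (DirectSum.component.lof_self ℂ (M := fun k => modTower k) l f)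
  · rcases k with k | k
    · exact congrArg Subtype.val
        (DirectSum.of_eq_of_ne (β := fun k => modTower k) l k f fun hk => h (hk ▸ rfl))
    · rfl

lemma compQM_of (k : ℤ) (l : ℕ) (f : qmTower l) :
    compQM k (ofQM l f) = if (l : ℤ) = k then (f : ℍ → ℂ) else 0 := by
  split_ifs with h
  · subst h
    exact congrArg Subtype.val (DirectSum.component.lof_self ℂ (M := fun k => qmTower k) l f)
  · rcases k with k | k
    · exact congrArg Subtype.val
        (DirectSum.of_eq_of_ne (β := fun k => qmTower k) l k f fun hk => h (hk ▸ rfl))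
    · rfl

lemma eq_zero_of_compM_eq_zero {x : ModTower} (h : ∀ k, compM k x = 0) : x = 0 :=
  DirectSum.ext_component (M := fun k => modTower k) ℂ fun k => Subtype.ext (h k)

lemma exists_isModular_compM (k : ℤ) (x : ModTower) :
    ∃ N : ℕ, N ≠ 0 ∧ IsModular N k (compM k x) := by
  rcases k with k | k
  · exact mem_modTower.mp (DirectSum.component ℂ ℕ (fun k => modTower k) k x).2
  · refine ⟨1, one_ne_zero, fun γ _ => SlashAction.zero_slash _ _, mdifferentiable_const,
      fun γ => ?_⟩
    simp only [compM, LinearMap.zero_apply, SlashAction.zero_slash]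
    exact Filter.const_boundedAtFilter _ 0

lemma compQM_inclM_mul_G2'_pow (w : ℤ) (i : ℕ) (a : ModTower) :
    compQM w (inclM a * G2' ^ i) = compM (w - 2 * i) a * G2 ^ i := by
  have key : compQM w ∘ₗ LinearMap.mulRight ℂ (G2' ^ i) ∘ₗ inclM =
      LinearMap.mulRight ℂ (G2 ^ i) ∘ₗ compM (w - 2 * i) := by
    refine LinearMap.ext_on_range span_range_ofM fun ⟨k, f⟩ => ?_
    simp only [LinearMap.comp_apply, LinearMap.mulRight_apply]
    rw [inclM_of_mul_G2'_pow, compQM_of, compM_of, ite_mul, zero_mul]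
    exact if_congr (by lia) rfl rfl
  exact LinearMap.congr_fun key a

lemma evalG2_single (i : ℕ) (a : ModTower) :
    evalG2 (Finsupp.single i a) = inclM a * G2' ^ i := by
  simp [evalG2]

lemma evalG2_eq_sum (p : ℕ →₀ ModTower) {n : ℕ} (hn : p.support ⊆ Finset.range n) :
    evalG2 p = ∑ i ∈ Finset.range n, inclM (p i) * G2' ^ i :=
  Finsupp.sum_of_support_subset p hn _ (fun i _ => by simp)

theorem evalG2_injective : Function.Injective evalG2 := by
  refine LinearMap.ker_eq_bot.mp (LinearMap.ker_eq_bot'.mpr fun p hp => ?_)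
  obtain ⟨n, hn⟩ := p.support.exists_nat_subset_range
  refine Finsupp.ext fun i => ?_
  by_cases hi : i < n
  · refine eq_zero_of_compM_eq_zero fun k => ?_
    choose N hN hmod using fun j : ℕ => exists_isModular_compM (k + 2 * i - 2 * j) (p j)
    have hcomp : ∑ j ∈ Finset.range n, compM (k + 2 * i - 2 * j) (p j) * G2 ^ j = 0 := by
      simpa only [evalG2_eq_sum p hn, map_sum, compQM_inclM_mul_G2'_pow, map_zero] using
        congrArg (compQM (k + 2 * i)) hp
    have hzero := eq_zero_of_sum_mul_G2_pow_eq_zero (Finset.prod_ne_zero_iff.mpr fun j _ => hN j)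
      (fun j hj => ((hmod j).mono (Finset.dvd_prod_of_mem N (Finset.mem_range.mpr hj))).1)
      hcomp i hi
    rwa [add_sub_cancel_right] at hzero
  · exact Finsupp.notMem_support_iff.mp fun h => hi (Finset.mem_range.mp (hn h))

lemma ofQM_mem_span_mul_G2'_pow (k : ℕ) (f : qmTower k) :
    ofQM k f ∈
      Submodule.span ℂ (Set.range fun p : ModTower × ℕ => inclM p.1 * G2' ^ p.2) := by
  set V := Submodule.span ℂ (Set.range fun p : ModTower × ℕ => inclM p.1 * G2' ^ p.2)
  obtain ⟨f, N, hN, s, hf⟩ := f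
  obtain ⟨g, hg, hfg⟩ := hf.exists_eq_sum_mul_G2_pow hN
  suffices ∀ i ∈ Finset.range (s + 1), g i * G2 ^ i ∈ (V.comap (ofQM k)).map (qmTower k).subtype by
    obtain ⟨f', hf', hff'⟩ := Submodule.sum_mem _ this
    rw [← hfg] at hff'
    obtain rfl : f' = ⟨f, N, hN, s, hf⟩ := Subtype.ext hff'
    exact hf'
  intro i hi
  have hgi := hg i (Nat.lt_succ_iff.mp (Finset.mem_range.mp hi))
  by_cases hik : 2 * i ≤ k
  · obtain ⟨l, rfl⟩ := Nat.exists_eq_add_of_le' hik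
    have hgl : g i ∈ modTower l := mem_modTower.mpr ⟨N, hN, by simpa using hgi⟩
    refine ⟨⟨_, mul_G2_pow_mem hgl i⟩, ?_, rfl⟩
    refine Submodule.mem_comap.mpr ?_
    rw [← inclM_of_mul_G2'_pow l ⟨g i, hgl⟩ i]
    exact Submodule.subset_span ⟨(_, i), rfl⟩
  · rw [hgi.eq_zero_of_neg hN (by lia), zero_mul]
    exact zero_mem _

theorem span_range_inclM_mul_G2'_pow :
    Submodule.span ℂ (Set.range fun p : ModTower × ℕ => inclM p.1 * G2' ^ p.2) = ⊤ := by
  rw [eq_top_iff, ← iSup_range_ofQM, iSup_le_iff]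
  rintro k _ ⟨f, rfl⟩
  exact ofQM_mem_span_mul_G2'_pow k f

lemma expansion_evalG2 (p : ℕ →₀ ModTower) : expansion (evalG2 p) = p :=
  evalG2_injective (LinearMap.congr_fun (exists_generalized_inverse evalG2).choose_spec p)

/-! ### Operators on the quasimodular tower -/

lemma extendToQM_mul_pow (T : ModTower →ₗ[ℂ] ModTower) (a : ModTower) (i : ℕ) :
    extendToQM T (inclM a * G2' ^ i) = inclM (T a) * G2' ^ i := by
  rw [← evalG2_single, ← evalG2_single, extendToQM, LinearMap.comp_apply, LinearMap.comp_apply,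
    expansion_evalG2, Finsupp.mapRange.linearMap_apply, Finsupp.mapRange_single]

lemma extendToQM_comp (S T : ModTower →ₗ[ℂ] ModTower) :
    extendToQM (S ∘ₗ T) = extendToQM S ∘ₗ extendToQM T :=
  LinearMap.ext_on_range span_range_inclM_mul_G2'_pow fun p => by
    simp only [LinearMap.comp_apply, extendToQM_mul_pow]

lemma extendToQM_add (S T : ModTower →ₗ[ℂ] ModTower) :
    extendToQM (S + T) = extendToQM S + extendToQM T :=
  LinearMap.ext_on_range span_range_inclM_mul_G2'_pow fun p => by
    simp only [LinearMap.add_apply, extendToQM_mul_pow, map_add, add_mul]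

lemma inclM_mul_pow_mul_inclM_mul_pow (a b : ModTower) (i j : ℕ) :
    inclM a * G2' ^ i * (inclM b * G2' ^ j) = inclM (a * b) * G2' ^ (i + j) := by
  rw [inclM_mul, pow_add]
  ring

lemma extendToQM_mul {T : ModTower →ₗ[ℂ] ModTower} (hT : ∀ a b, T (a * b) = T a * T b)
    (x y : QMTower) : extendToQM T (x * y) = extendToQM T x * extendToQM T y :=
  map_mul_of_span_eq_top span_range_inclM_mul_G2'_pow
    (fun p q => by
      simp only [inclM_mul_pow_mul_inclM_mul_pow, extendToQM_mul_pow, hT]) x y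

lemma extendToQM_leibniz {T : ModTower →ₗ[ℂ] ModTower}
    (hT : ∀ a b, T (a * b) = T a * b + a * T b) (x y : QMTower) :
    extendToQM T (x * y) = extendToQM T x * y + x * extendToQM T y :=
  leibniz_of_span_eq_top span_range_inclM_mul_G2'_pow
    (fun p q => by
      simp only [inclM_mul_pow_mul_inclM_mul_pow, extendToQM_mul_pow, hT, map_add, add_mul]) x y

lemma slashFun_mul (k l : ℕ) (α : GL(2, ℚ)⁺) (f g : ℍ → ℂ) :
    slashFun (k + l) α (f * g) = slashFun k α f * slashFun l α g := by
  ext z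
  simp only [slashFun, Pi.mul_apply, pow_add, mul_inv]
  ring

lemma slashFun_slashFun (k : ℕ) (α β : GL(2, ℚ)⁺) (f : ℍ → ℂ) :
    slashFun k β (slashFun k α f) = slashFun k (α * β) f := by
  have hmul : toReal (α * β) = toReal α * toReal β := by simp [toReal]
  ext z
  have hdenom : denom (toReal (α * β)) z =
      denom (toReal α) ↑(toReal β • z) * denom (toReal β) z := by
    rw [hmul, denom_cocycle_σ, σ, if_pos (toReal_det_pos β), ContinuousAlgEquiv.refl_apply]
  rw [slashFun, slashFun, slashFun, hdenom, hmul, mul_smul, mul_pow, mul_inv]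
  ring

lemma slashFun_slToGL (k : ℕ) (γ : SL(2, ℤ)) (f : ℍ → ℂ) :
    slashFun k (slToGL γ) f = f ∣[(k : ℤ)] γ := by
  have hreal : toReal (slToGL γ) = mapGL ℝ γ := by
    ext i j
    simp [toReal, slToGL]
  have hdet : ((mapGL ℝ γ : GL (Fin 2) ℝ).det.val : ℂ) = 1 := by simp
  rw [slashFun_eq, hreal, hdet, one_zpow, inv_one, one_smul]
  rfl

lemma slashM_of (α : GL(2, ℚ)⁺) (k : ℕ) (f : modTower k) :
    slashM α (ofM k f) = ofM k ⟨slashFun k α f, slashFun_mem α f.2⟩ :=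
  liftM_of _ k f

lemma XM_of (k : ℕ) (f : modTower k) : XM (ofM k f) = ofM (k + 2) ⟨XFun k f, XFun_mem f.2⟩ :=
  liftM_of _ k f

lemma YM_of (k : ℕ) (f : modTower k) : YM (ofM k f) = (k / 2 : ℂ) • ofM k f :=
  liftM_of _ k f

lemma slashM_mul (α : GL(2, ℚ)⁺) (a b : ModTower) :
    slashM α (a * b) = slashM α a * slashM α b := by
  refine map_mul_of_span_eq_top span_range_ofM (fun p q => ?_) a b
  rw [ofM_mul, slashM_of, slashM_of, slashM_of, ofM_mul]
  exact ofM_congr rfl (slashFun_mul _ _ _ _ _)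

lemma slashM_comp (α β : GL(2, ℚ)⁺) : slashM β ∘ₗ slashM α = slashM (α * β) := by
  refine LinearMap.ext_on_range span_range_ofM fun p => ?_
  rw [LinearMap.comp_apply, slashM_of, slashM_of, slashM_of]
  exact ofM_congr rfl (slashFun_slashFun _ _ _ _)

lemma XM_mul (a b : ModTower) : XM (a * b) = XM a * b + a * XM b := by
  refine leibniz_of_span_eq_top span_range_ofM (fun ⟨k, f⟩ ⟨l, g⟩ => ?_) a b
  have hleibniz : XFun (k + l) (f * g) = XFun k f * g + f * XFun l g := by
    simp only [XFun_eq, Nat.cast_add]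
    exact Derivative.serreDerivative_mul _ _ _ _ (mdiff_of_mem f.2) (mdiff_of_mem g.2)
  have hfg : ofM (k + 2 + l) ⟨XFun k f * g, SetLike.GradedMul.mul_mem (XFun_mem f.2) g.2⟩ =
      ofM (k + l + 2) ⟨XFun k f * g,
        add_right_comm k 2 l ▸ SetLike.GradedMul.mul_mem (XFun_mem f.2) g.2⟩ :=
    ofM_congr (add_right_comm k 2 l) rfl
  rw [ofM_mul, XM_of, XM_of, XM_of, ofM_mul, ofM_mul, hfg]
  exact (ofM_congr rfl hleibniz).trans (map_add (ofM (k + l + 2)) _ _)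

lemma YM_mul (a b : ModTower) : YM (a * b) = YM a * b + a * YM b := by
  refine leibniz_of_span_eq_top span_range_ofM (fun ⟨k, f⟩ ⟨l, g⟩ => ?_) a b
  rw [YM_of, YM_of, smul_mul_assoc, mul_smul_comm, ofM_mul, YM_of, ← add_smul, Nat.cast_add,
    add_div]

lemma XM_comp_slashM (γ : SL(2, ℤ)) :
    XM ∘ₗ slashM (slToGL γ) = slashM (slToGL γ) ∘ₗ XM := by
  refine LinearMap.ext_on_range span_range_ofM fun ⟨k, f⟩ => ?_
  rw [LinearMap.comp_apply, LinearMap.comp_apply, slashM_of, XM_of, XM_of, slashM_of]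
  refine ofM_congr rfl ?_
  simp only [XFun_eq, slashFun_slToGL]
  exact_mod_cast
    (Derivative.serreDerivative_slash_equivariant (k := k) (mdiff_of_mem f.2) (γ := γ)).symm

lemma YM_comp_slashM (α : GL(2, ℚ)⁺) : YM ∘ₗ slashM α = slashM α ∘ₗ YM := by
  refine LinearMap.ext_on_range span_range_ofM fun p => ?_
  rw [LinearMap.comp_apply, LinearMap.comp_apply, YM_of, map_smul, slashM_of, YM_of]

lemma YM_comp_XM : YM ∘ₗ XM = XM ∘ₗ YM + XM := by
  refine LinearMap.ext_on_range span_range_ofM fun ⟨k, f⟩ => ?_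
  rw [LinearMap.add_apply, LinearMap.comp_apply, LinearMap.comp_apply, YM_of, map_smul, XM_of,
    YM_of, Nat.cast_add, Nat.cast_ofNat, add_div, div_self two_ne_zero, add_smul, one_smul]

lemma slashQM_mul (α : GL(2, ℚ)⁺) (x y : QMTower) :
    slashQM α (x * y) = slashQM α x * slashQM α y :=
  extendToQM_mul (slashM_mul α) x y

lemma slashQM_slashQM (α β : GL(2, ℚ)⁺) (x : QMTower) :
    slashQM β (slashQM α x) = slashQM (α * β) x := by
  rw [slashQM, slashQM, slashQM, ← slashM_comp, extendToQM_comp, LinearMap.comp_apply]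

lemma XQM_comp_slashQM (γ : SL(2, ℤ)) :
    XQM ∘ₗ slashQM (slToGL γ) = slashQM (slToGL γ) ∘ₗ XQM := by
  rw [XQM, slashQM, ← extendToQM_comp, ← extendToQM_comp, XM_comp_slashM]

lemma YQM_comp_slashQM (α : GL(2, ℚ)⁺) : YQM ∘ₗ slashQM α = slashQM α ∘ₗ YQM := by
  rw [YQM, slashQM, ← extendToQM_comp, ← extendToQM_comp, YM_comp_slashM]

lemma XQM_mul (x y : QMTower) : XQM (x * y) = XQM x * y + x * XQM y :=
  extendToQM_leibniz XM_mul x y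

lemma YQM_mul (x y : QMTower) : YQM (x * y) = YQM x * y + x * YQM y :=
  extendToQM_leibniz YM_mul x y

lemma YQM_comp_XQM : YQM ∘ₗ XQM = XQM ∘ₗ YQM + XQM := by
  rw [XQM, YQM, ← extendToQM_comp, ← extendToQM_comp, YM_comp_XM, extendToQM_add]

/-! ### Actions of the enveloping algebra -/

section EnvelopingAlgebra

open UniversalEnvelopingAlgebra

variable {R L V W : Type*} [CommRing R] [LieRing L] [LieAlgebra R L]
  [AddCommGroup V] [Module R V] [AddCommGroup W] [Module R W]

variable (R L) in
lemma adjoin_range_ι_eq_top :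
    Algebra.adjoin R (Set.range (ι R : L → UniversalEnvelopingAlgebra R L)) = ⊤ := by
  set S := Algebra.adjoin R (Set.range (ι R : L → UniversalEnvelopingAlgebra R L))
  let ιS : L →ₗ⁅R⁆ S :=
    { (ι R : L →ₗ⁅R⁆ UniversalEnvelopingAlgebra R L).toLinearMap.codRestrict S.toSubmodule
        fun u => Algebra.subset_adjoin ⟨u, rfl⟩ with
      map_lie' := fun {u v} => Subtype.ext ((ι R).map_lie u v) }
  have hid : S.val.comp (lift R ιS) = AlgHom.id R _ :=
    hom_ext R <| LieHom.ext fun u => congrArg Subtype.val (lift_ι_apply R ιS u)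
  refine eq_top_iff.mpr fun h _ => ?_
  rw [← show (lift R ιS h : UniversalEnvelopingAlgebra R L) = h from DFunLike.congr_fun hid h]
  exact (lift R ιS h).2

lemma comp_eq_comp_of_forall_ι (A : UniversalEnvelopingAlgebra R L →ₐ[R] Module.End R V)
    (B : UniversalEnvelopingAlgebra R L →ₐ[R] Module.End R W) (p : V →ₗ[R] W)
    (hp : ∀ u, B (ι R u) ∘ₗ p = p ∘ₗ A (ι R u)) (h : UniversalEnvelopingAlgebra R L) :
    B h ∘ₗ p = p ∘ₗ A h := by
  induction (adjoin_range_ι_eq_top R L).ge (Algebra.mem_top (x := h)) using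
    Algebra.adjoin_induction with
  | mem _ hu => obtain ⟨u, rfl⟩ := hu; exact hp u
  | algebraMap c =>
    ext v
    simp only [AlgHom.commutes, LinearMap.comp_apply, Module.algebraMap_end_apply, map_smul]
  | add a b _ _ ha hb => rw [map_add, map_add, LinearMap.add_comp, LinearMap.comp_add, ha, hb]
  | mul a b _ _ ha hb =>
    rw [map_mul, map_mul, Module.End.mul_eq_comp, Module.End.mul_eq_comp, ← LinearMap.comp_assoc,
      ← ha, LinearMap.comp_assoc, hb, LinearMap.comp_assoc]

end EnvelopingAlgebra

lemma coproduct_ι (u : L1) : coproduct (UniversalEnvelopingAlgebra.ι ℂ u) =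
    UniversalEnvelopingAlgebra.ι ℂ u ⊗ₜ[ℂ] 1 + 1 ⊗ₜ[ℂ] UniversalEnvelopingAlgebra.ι ℂ u :=
  UniversalEnvelopingAlgebra.lift_ι_apply ℂ _ u

lemma endTensorEndAlgHom_map_tmul {R A B V W : Type*} [CommRing R] [Ring A] [Algebra R A]
    [Ring B] [Algebra R B] [AddCommGroup V] [Module R V] [AddCommGroup W] [Module R W]
    (f : A →ₐ[R] Module.End R V) (g : B →ₐ[R] Module.End R W) (t : A ⊗[R] B) (v : V) (w : W) :
    Module.endTensorEndAlgHom (S := R) (A := R) (Algebra.TensorProduct.map f g t) (v ⊗ₜ[R] w) =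
      TensorProduct.map (f.toLinearMap.flip v) (g.toLinearMap.flip w) t := by
  induction t using TensorProduct.induction_on with
  | zero => simp only [map_zero, LinearMap.zero_apply]
  | tmul a b => rfl
  | add s t hs ht => rw [map_add, map_add, LinearMap.add_apply, hs, ht, map_add]

lemma lift_apply_bilin_eq_coproduct {U V W : Type*} [AddCommGroup U] [Module ℂ U]
    [AddCommGroup V] [Module ℂ V] [AddCommGroup W] [Module ℂ W] (ρU : L1 →ₗ⁅ℂ⁆ Module.End ℂ U)
    (ρV : L1 →ₗ⁅ℂ⁆ Module.End ℂ V) (ρW : L1 →ₗ⁅ℂ⁆ Module.End ℂ W) (p : V →ₗ[ℂ] W →ₗ[ℂ] U)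
    (hp : ∀ u v w, ρU u (p v w) = p (ρV u v) w + p v (ρW u w)) (h : H1) (v : V) (w : W) :
    UniversalEnvelopingAlgebra.lift ℂ ρU h (p v w) =
      TensorProduct.lift p (TensorProduct.map
        ((UniversalEnvelopingAlgebra.lift ℂ ρV).toLinearMap.flip v)
        ((UniversalEnvelopingAlgebra.lift ℂ ρW).toLinearMap.flip w) (coproduct h)) := by
  let T : H1 →ₐ[ℂ] Module.End ℂ (V ⊗[ℂ] W) := Module.endTensorEndAlgHom.comp
    ((Algebra.TensorProduct.map (UniversalEnvelopingAlgebra.lift ℂ ρV)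
      (UniversalEnvelopingAlgebra.lift ℂ ρW)).comp coproduct)
  have hT (h : H1) (v : V) (w : W) : T h (v ⊗ₜ w) = TensorProduct.map
      ((UniversalEnvelopingAlgebra.lift ℂ ρV).toLinearMap.flip v)
      ((UniversalEnvelopingAlgebra.lift ℂ ρW).toLinearMap.flip w) (coproduct h) :=
    endTensorEndAlgHom_map_tmul _ _ (coproduct h) v w
  rw [← hT]
  refine LinearMap.congr_fun (comp_eq_comp_of_forall_ι T (UniversalEnvelopingAlgebra.lift ℂ ρU)
    (TensorProduct.lift p) (fun u => TensorProduct.ext' fun v w => ?_) h) (v ⊗ₜ w)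
  rw [LinearMap.comp_apply, LinearMap.comp_apply, hT, coproduct_ι]
  simp only [map_add, TensorProduct.map_tmul, TensorProduct.lift.tmul, LinearMap.flip_apply,
    AlgHom.toLinearMap_apply, UniversalEnvelopingAlgebra.lift_ι_apply, map_one,
    Module.End.one_apply, hp]

/-! ### The pairing -/

section RightCosets

variable {G : Type*} [Group G] {H : Subgroup G}

/-- The right translation `Hg ↦ Hga` of `H \ G`. -/
def rightCosetMul (a : G) :
    Quotient (QuotientGroup.rightRel H) ≃ Quotient (QuotientGroup.rightRel H) :=
  Quotient.congr (Equiv.mulRight a) fun x y => by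
    simp [QuotientGroup.rightRel_apply, mul_assoc]

lemma rightCosetMul_mk (a g : G) :
    rightCosetMul a (Quotient.mk (QuotientGroup.rightRel H) g) = Quotient.mk _ (g * a) :=
  rfl

lemma rightCosetMul_rightCosetMul (a b : G) (x : Quotient (QuotientGroup.rightRel H)) :
    rightCosetMul b (rightCosetMul a x) = rightCosetMul (a * b) x := by
  induction x using Quotient.inductionOn
  simp only [rightCosetMul_mk, mul_assoc]

end RightCosets

instance finite_SLCosets {N : ℕ} [NeZero N] : Finite (SLCosets N) :=
  Finite.of_equiv _ (QuotientGroup.quotientRightRelEquivQuotientLeftRel (Gamma N)).symm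

variable {N : ℕ} {σ : SL(2, ℤ)}

lemma coset_slToGL_mul {γ : SL(2, ℤ)} (hγ : γ ∈ Gamma N) (α : GL(2, ℚ)⁺) :
    coset N (slToGL γ * α) = coset N α := by
  refine Quotient.sound (QuotientGroup.rightRel_apply.mpr ?_)
  rw [mul_inv_rev, mul_inv_cancel_left, ← map_inv]
  exact ⟨γ⁻¹, inv_mem hγ, rfl⟩

lemma Qtw_apply_rightCosetMul (F : Qtw N σ) {γ : SL(2, ℤ)} (hγ : γ ∈ Gamma N) (x : Cosets N) :
    F.1 (rightCosetMul (slToGL γ) x) = slashQM (slToGL (σ * γ * σ⁻¹)) (F.1 x) :=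
  Quotient.inductionOn x (F.2.2 γ hγ)

/-- The summand `F¹_{βσ} · (F²_{xσ⁻¹β⁻¹} ‖ σβ)` of the pairing at the coset `x`, as a function of
the coset `Γ(N)β`. -/
def pairingSummand (F₁ F₂ : Qtw N σ) (x : Cosets N) : SLCosets N → QMTower :=
  Quotient.lift (fun β => F₁.1 (coset N (slToGL (β * σ))) *
      slashQM (slToGL (σ * β)) (F₂.1 (rightCosetMul (slToGL (σ⁻¹ * β⁻¹)) x))) fun β β' hβ => by
    obtain ⟨γ, hγ, rfl⟩ : ∃ γ ∈ Gamma N, β = γ * β' :=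
      ⟨β * β'⁻¹, QuotientGroup.rightRel_apply.mp ((QuotientGroup.rightRel _).symm hβ),
        (inv_mul_cancel_right β β').symm⟩
    have hF₂ : F₂.1 (rightCosetMul (slToGL (σ⁻¹ * (γ * β')⁻¹)) x) =
        slashQM (slToGL (σ * γ⁻¹ * σ⁻¹)) (F₂.1 (rightCosetMul (slToGL (σ⁻¹ * β'⁻¹)) x)) := by
      rw [← Qtw_apply_rightCosetMul F₂ (inv_mem hγ), rightCosetMul_rightCosetMul, ← map_mul,
        mul_inv_rev, mul_assoc]
    have hσ : σ * γ⁻¹ * σ⁻¹ * (σ * (γ * β')) = σ * β' := by group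
    rw [hF₂, slashQM_slashQM, ← map_mul, hσ, mul_assoc γ, map_mul, coset_slToGL_mul hγ]

lemma pairingSummand_mk (F₁ F₂ : Qtw N σ) (x : Cosets N) (β : SL(2, ℤ)) :
    pairingSummand F₁ F₂ x (Quotient.mk _ β) = F₁.1 (coset N (slToGL (β * σ))) *
      slashQM (slToGL (σ * β)) (F₂.1 (rightCosetMul (slToGL (σ⁻¹ * β⁻¹)) x)) :=
  rfl

lemma pairingFormula_eq_finsum {r : SLCosets N → SL(2, ℤ)} (hr : ∀ q, Quotient.mk _ (r q) = q)
    (F₁ F₂ : Qtw N σ) (α : GL(2, ℚ)⁺) :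
    pairingFormula r F₁ F₂ α = ∑ᶠ q, pairingSummand F₁ F₂ (coset N α) q :=
  finsum_congr fun q => by
    conv_rhs => rw [← hr q]
    rfl

lemma pairingSummand_rightCosetMul (F₁ F₂ : Qtw N σ) (x : Cosets N) {γ : SL(2, ℤ)}
    (hγ : γ ∈ Gamma N) (q : SLCosets N) :
    pairingSummand F₁ F₂ (rightCosetMul (slToGL γ) x) (rightCosetMul (σ * γ * σ⁻¹) q) =
      slashQM (slToGL (σ * γ * σ⁻¹)) (pairingSummand F₁ F₂ x q) := by
  induction q using Quotient.inductionOn with | h β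
  have hF₁ : β * (σ * γ * σ⁻¹) * σ = β * σ * γ := by group
  have hF₂ : γ * (σ⁻¹ * (β * (σ * γ * σ⁻¹))⁻¹) = σ⁻¹ * β⁻¹ := by group
  rw [rightCosetMul_mk, pairingSummand_mk, pairingSummand_mk, slashQM_mul, slashQM_slashQM,
    ← Qtw_apply_rightCosetMul F₁ hγ, rightCosetMul_rightCosetMul, ← map_mul, ← map_mul, hF₁, hF₂,
    map_mul slToGL (β * σ), mul_assoc σ β]
  rfl

lemma finite_support_finsum_pairingSummand [Finite (SLCosets N)] (F₁ F₂ : Qtw N σ) :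
    (Function.support fun x => ∑ᶠ q, pairingSummand F₁ F₂ x q).Finite := by
  have hfin (β : SL(2, ℤ)) :
      (rightCosetMul (slToGL (σ⁻¹ * β⁻¹)) ⁻¹' Function.support F₂.1 : Set (Cosets N)).Finite :=
    F₂.2.1.preimage (Equiv.injective _).injOn
  refine (Set.finite_iUnion fun q : SLCosets N => hfin q.out).subset fun x hx => ?_
  obtain ⟨q, hq⟩ : ∃ q, pairingSummand F₁ F₂ x q ≠ 0 := by
    contrapose! hx
    exact Function.notMem_support.mpr (finsum_eq_zero_of_forall_eq_zero hx)
  rw [← Quotient.out_eq q, pairingSummand_mk] at hq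
  exact Set.mem_iUnion.mpr ⟨q, fun h => hq (by rw [h, map_zero, mul_zero])⟩

/-- The pairing `(F¹, F²)` as a bilinear map on `Q_σ(Γ(N))`. -/
def pairing [Finite (SLCosets N)] : Qtw N σ →ₗ[ℂ] Qtw N σ →ₗ[ℂ] Qtw N σ :=
  LinearMap.mk₂ ℂ
    (fun F₁ F₂ => ⟨fun x => ∑ᶠ q, pairingSummand F₁ F₂ x q,
      finite_support_finsum_pairingSummand F₁ F₂, fun γ hγ α => by
        rw [map_finsum _ (Set.toFinite _)]
        exact (finsum_comp_equiv (rightCosetMul (σ * γ * σ⁻¹))).symm.trans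
          (finsum_congr (pairingSummand_rightCosetMul F₁ F₂ (coset N α) hγ))⟩)
    (fun F F' G => Subtype.ext <| funext fun x =>
      (finsum_congr fun q => Quotient.inductionOn q fun β => add_mul _ _ _).trans
        (finsum_add_distrib (Set.toFinite _) (Set.toFinite _)))
    (fun c F G => Subtype.ext <| funext fun x =>
      (finsum_congr fun q => Quotient.inductionOn q fun β => smul_mul_assoc c _ _).trans
        (smul_finsum' c (Set.toFinite _)).symm)
    (fun F G G' => Subtype.ext <| funext fun x =>
      (finsum_congr fun q => Quotient.inductionOn q fun β =>
        (congrArg _ (map_add _ _ _)).trans (mul_add _ _ _)).trans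
        (finsum_add_distrib (Set.toFinite _) (Set.toFinite _)))
    (fun c F G => Subtype.ext <| funext fun x =>
      (finsum_congr fun q => Quotient.inductionOn q fun β =>
        (congrArg _ (map_smul _ c _)).trans (mul_smul_comm c _ _)).trans
        (smul_finsum' c (Set.toFinite _)).symm)

lemma valueAt_pairing [Finite (SLCosets N)] {r : SLCosets N → SL(2, ℤ)}
    (hr : ∀ q, Quotient.mk _ (r q) = q) (F₁ F₂ : Qtw N σ) (α : GL(2, ℚ)⁺) :
    valueAt (pairing F₁ F₂) α = pairingFormula r F₁ F₂ α :=
  (pairingFormula_eq_finsum hr F₁ F₂ α).symm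

/-! ### The action of `l₁` on `Q_σ(Γ(N))` -/

/-- The operator `F ↦ (α ↦ D(F_α))` on `Q_σ(Γ(N))` given by an operator `D` on `QM` that commutes
with `‖γ` for all `γ ∈ SL₂(ℤ)`. -/
def mapQtw (D : QMTower →ₗ[ℂ] QMTower)
    (hD : ∀ γ : SL(2, ℤ), D ∘ₗ slashQM (slToGL γ) = slashQM (slToGL γ) ∘ₗ D) :
    Module.End ℂ (Qtw N σ) :=
  (D.compLeft (Cosets N)).restrict fun _ hF =>
    ⟨hF.1.subset fun _ => mt fun h => (congrArg D h).trans (map_zero D), fun γ hγ α =>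
      (congrArg D (hF.2 γ hγ α)).trans (LinearMap.congr_fun (hD _) _)⟩

lemma mapQtw_pairing [Finite (SLCosets N)] {D : QMTower →ₗ[ℂ] QMTower}
    (hD : ∀ γ : SL(2, ℤ), D ∘ₗ slashQM (slToGL γ) = slashQM (slToGL γ) ∘ₗ D)
    (hmul : ∀ x y, D (x * y) = D x * y + x * D y) (F₁ F₂ : Qtw N σ) :
    mapQtw D hD (pairing F₁ F₂) =
      pairing (mapQtw D hD F₁) F₂ + pairing F₁ (mapQtw D hD F₂) := by
  have hsummand (x : Cosets N) (q : SLCosets N) : D (pairingSummand F₁ F₂ x q) =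
      pairingSummand (mapQtw D hD F₁) F₂ x q + pairingSummand F₁ (mapQtw D hD F₂) x q := by
    induction q using Quotient.inductionOn
    simp only [pairingSummand_mk, hmul, ← LinearMap.comp_apply, hD]
    rfl
  refine Subtype.ext <| funext fun x => (map_finsum D (Set.toFinite _)).trans ?_
  exact (finsum_congr (hsummand x)).trans
    (finsum_add_distrib (Set.toFinite _) (Set.toFinite _))

/-- The operator `X` on `Q_σ(Γ(N))`. -/
def XQ : Module.End ℂ (Qtw N σ) := mapQtw XQM XQM_comp_slashQM

/-- The operator `Y` on `Q_σ(Γ(N))`. -/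
def YQ : Module.End ℂ (Qtw N σ) := mapQtw YQM fun γ => YQM_comp_slashQM (slToGL γ)

lemma YQ_mul_XQ : (YQ * XQ : Module.End ℂ (Qtw N σ)) = XQ * YQ + XQ :=
  LinearMap.ext fun F => Subtype.ext <| funext fun x => LinearMap.congr_fun YQM_comp_XQM (F.1 x)

/-- The Lie action of `l₁` on `Q_σ(Γ(N))`. -/
def lieAction : L1 →ₗ⁅ℂ⁆ Module.End ℂ (Qtw N σ) where
  toFun u := u.1 • XQ + u.2 • YQ
  map_add' u v := by rw [L1.add_fst, L1.add_snd]; module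
  map_smul' c u := by rw [L1.smul_fst, L1.smul_snd, RingHom.id_apply]; module
  map_lie' {u v} := by
    rw [L1.lie_fst, L1.lie_snd, LieRing.of_associative_ring_bracket]
    simp only [mul_add, add_mul, smul_mul_smul_comm, YQ_mul_XQ]
    module

lemma lieAction_apply (u : L1) :
    (lieAction u : Module.End ℂ (Qtw N σ)) = u.1 • XQ + u.2 • YQ := rfl

lemma lieAction_X : (lieAction L1.X : Module.End ℂ (Qtw N σ)) = XQ :=
  show (1 : ℂ) • XQ + (0 : ℂ) • YQ = XQ by module

lemma lieAction_Y : (lieAction L1.Y : Module.End ℂ (Qtw N σ)) = YQ :=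
  show (0 : ℂ) • XQ + (1 : ℂ) • YQ = YQ by module

lemma lieAction_pairing [Finite (SLCosets N)] (u : L1) (F₁ F₂ : Qtw N σ) :
    lieAction u (pairing F₁ F₂) =
      pairing (lieAction u F₁) F₂ + pairing F₁ (lieAction u F₂) := by
  simp only [lieAction_apply, LinearMap.add_apply, LinearMap.smul_apply, map_add, map_smul,
    XQ, YQ, mapQtw_pairing _ XQM_mul, mapQtw_pairing _ YQM_mul]
  module

end QMHecke

end

theorem mainTheorem8 (N : ℕ) (hN : 1 ≤ N) (σ : SL(2, ℤ)) :
    ∃ pair : QMHecke.Qtw N σ →ₗ[ℂ] QMHecke.Qtw N σ →ₗ[ℂ] QMHecke.Qtw N σ,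
      (∀ r : QMHecke.SLCosets N → SL(2, ℤ), (∀ q, Quotient.mk _ (r q) = q) →
        ∀ (F₁ F₂ : QMHecke.Qtw N σ) (α : GL(2, ℚ)⁺),
          QMHecke.valueAt (pair F₁ F₂) α = QMHecke.pairingFormula r F₁ F₂ α) ∧
      ∃ ρ : QMHecke.L1 →ₗ⁅ℂ⁆ Module.End ℂ (QMHecke.Qtw N σ),
        (∀ (F : QMHecke.Qtw N σ) (α : GL(2, ℚ)⁺),
          QMHecke.valueAt (ρ QMHecke.L1.X F) α = QMHecke.XQM (QMHecke.valueAt F α) ∧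
          QMHecke.valueAt (ρ QMHecke.L1.Y F) α = QMHecke.YQM (QMHecke.valueAt F α)) ∧
        ∀ (h : QMHecke.H1) (F₁ F₂ : QMHecke.Qtw N σ),
          UniversalEnvelopingAlgebra.lift ℂ ρ h (pair F₁ F₂) =
            TensorProduct.lift pair
              (TensorProduct.map
                ((UniversalEnvelopingAlgebra.lift ℂ ρ).toLinearMap.flip F₁)
                ((UniversalEnvelopingAlgebra.lift ℂ ρ).toLinearMap.flip F₂)
                (QMHecke.coproduct h)) := by
  have : NeZero N := ⟨Nat.one_le_iff_ne_zero.mp hN⟩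
  refine ⟨QMHecke.pairing, fun r hr F₁ F₂ α => QMHecke.valueAt_pairing hr F₁ F₂ α,
    QMHecke.lieAction, fun F α => ?_, fun h F₁ F₂ => ?_⟩
  · rw [QMHecke.lieAction_X, QMHecke.lieAction_Y]
    exact ⟨rfl, rfl⟩
  · exact QMHecke.lift_apply_bilin_eq_coproduct _ _ _ QMHecke.pairing
      QMHecke.lieAction_pairing h F₁ F₂
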